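/- Let $\mathfrak g$ be a finite-dimensional simple complex Lie algebra with Killing form $K$, let $\mathfrak h$ be a Cartan subalgebra, $R$ the set of roots, $\mathfrak g_\beta$ the root space of $\beta\in R$, $\Gamma\subset R$ a set of simple roots, and $\alpha_{\max}=\sum_{\beta\in\Gamma}k_\beta\beta$ the highest root. Fix $\alpha\in\Gamma$ and put $k=k_\alpha$. Let $a(u)=1/(1-u)^2$ and equip $\mathfrak g((u))$ with the form $Q_{a(u)}(f_1,f_2)=\mathrm{Res}_{u=0}\bigl(a(u)K(f_1,f_2)\bigr)$, where $K$ also denotes the Killing form of $\mathfrak g((u))$ over $\mathbb C((u))$. Let $h_\alpha\in\mathfrak h$ be the element with $\alpha(h_\alpha)=1/k$ and $\beta(h_\alpha)=0$ for $\beta\in\Gamma\setminus\{\alpha\}$. Let $v$ be the valuation of $\mathbb C((u^{-1}))$ given by $v(\sum_{n\ge m}a_nu^{-n})=m$ if $a_m\neq 0$ (and $v(0)=\infty$), and put $$\mathbb O_\alpha=\mathfrak h[[u^{-1}]]\oplus\bigoplus_{\beta\in R}\{f\in\mathbb C((u^{-1})):v(f)\ge\beta(h_\alpha)\}\otimes\mathfrak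 g_\beta\subset\mathfrak g((u^{-1})).$$ Let $P_\alpha^-$ be the sum of $\mathfrak h$, the root spaces of all negative roots, and the root spaces of all positive roots in which $\alpha$ has coefficient $0$; let $(P_\alpha^-)^\perp$ be its orthogonal complement in $\mathfrak g$ with respect to $K$. Equip $\mathfrak g[\varepsilon]$, $\varepsilon^2=0$, with the form $\bar Q_\varepsilon(x_1+\varepsilon x_2,y_1+\varepsilon y_2)=K(x_1,y_2)+K(x_2,y_1)$. A complex Lie subalgebra is Lagrangian if it equals its own orthogonal complement, and two subspaces are transversal if their direct sum is the whole space. (i) If $k=1$, then $$W\longmapsto\{p|_{u^{-1}=1+\varepsilon}:p\in W\}$$ is a bijection from the set of Lagrangian subalgebras $W$ of $\mathfrak g((u))$, with respect to $Q_{a(u)}$, that are transversal to $\mathfrak g[[u]]$ and satisfy $W\subseteq\mathbb O_\alpha\cap\mathfrak g[u,u^{-1}]$, onto the set of Lagrangian subalgebras of $\mathfrak g[\varepsilon]$, with respect to $\bar Q_\varepsilon$, that are transversal to $P_\alpha^-+\varepsilon(P_\alpha^-)^\perp$. (ii) If $k>1$, there is no Lagrangian subalgebra $W$ of $\mathfrak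 g((u))$, with respect to $Q_{a(u)}$, that is transversal to $\mathfrak g[[u]]$ and satisfies $W\subseteq\mathbb O_\alpha\cap\mathfrak g[u,u^{-1}]$. -/

import Mathlib

open scoped TensorProduct LaurentPolynomial

noncomputable section

namespace LieBialg

variable {𝔤 : Type*} [LieRing 𝔤] [LieAlgebra ℂ 𝔤]

/-! Mathlib has two propositionally (not definitionally) equal `ℂ`-algebra structures on the Laurent
series; the one compatible with the coefficientwise vector space structure is to be used. -/

instance instAlgebraLaurent : Algebra ℂ (LaurentSeries ℂ) := HahnSeries.instAlgebra

instance instModuleLaurent : Module ℂ (LaurentSeries ℂ) := Algebra.toModule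

instance instSMulLaurent : SMul ℂ (LaurentSeries ℂ) := Algebra.toSMul

/-! ### The coefficient rings and the changes of coefficients -/

/-- Substitution of a unit `x` of a commutative `ℂ`-algebra `A` for the variable:
the algebra map `ℂ[u, u⁻¹] → A` with `u ↦ x`. -/
def substUnit {A : Type*} [CommRing A] [Algebra ℂ A] (x : Aˣ) : ℂ[T;T⁻¹] →ₐ[ℂ] A where
  toRingHom := LaurentPolynomial.eval₂ (algebraMap ℂ A) x
  commutes' c := LaurentPolynomial.eval₂_C (algebraMap ℂ A) x c

/-- The variable of a field of Laurent series, as a unit. -/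
def laurentVar : (LaurentSeries ℂ)ˣ where
  val := HahnSeries.single 1 1
  inv := HahnSeries.single (-1) 1
  val_inv := by simp
  inv_val := by simp

/-- The unit `1 + ε` of the dual numbers `ℂ[ε]`, with inverse `1 - ε`. -/
def onePlusEps : (DualNumber ℂ)ˣ where
  val := 1 + DualNumber.eps
  inv := 1 - DualNumber.eps
  val_inv := by
    have h : (DualNumber.eps : DualNumber ℂ) * DualNumber.eps = 0 := DualNumber.eps_mul_eps
    linear_combination -h
  inv_val := by
    have h : (DualNumber.eps : DualNumber ℂ) * DualNumber.eps = 0 := DualNumber.eps_mul_eps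
    linear_combination -h

variable (𝔤)

/-- The inclusion `𝔤[u, u⁻¹] → 𝔤((u))`. The loop algebra `𝔤[u, u⁻¹]` is `ℂ[u, u⁻¹] ⊗ 𝔤`, and
`𝔤((u))` is `ℂ((u)) ⊗ 𝔤` (the algebra `𝔤` being finite dimensional). -/
def toLaurentAtZero : ℂ[T;T⁻¹] ⊗[ℂ] 𝔤 →ₗ⁅ℂ⁆ LaurentSeries ℂ ⊗[ℂ] 𝔤 :=
  LieAlgebra.ExtendScalars.map (substUnit laurentVar) LieHom.id

/-- The inclusion `𝔤[u, u⁻¹] → 𝔤((u⁻¹))`. Here the variable of the Laurent series is `u⁻¹`, so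
that `u` goes to the inverse of the variable. -/
def toLaurentAtInfty : ℂ[T;T⁻¹] ⊗[ℂ] 𝔤 →ₗ⁅ℂ⁆ LaurentSeries ℂ ⊗[ℂ] 𝔤 :=
  LieAlgebra.ExtendScalars.map (substUnit laurentVar⁻¹) LieHom.id

/-- Evaluation `𝔤[u, u⁻¹] → 𝔤[ε]` at `u⁻¹ = 1 + ε`, that is, at `u = (1 + ε)⁻¹ = 1 - ε`.
The algebra `𝔤[ε]` is `ℂ[ε] ⊗ 𝔤`. -/
def evalEps : ℂ[T;T⁻¹] ⊗[ℂ] 𝔤 →ₗ⁅ℂ⁆ DualNumber ℂ ⊗[ℂ] 𝔤 :=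
  LieAlgebra.ExtendScalars.map (substUnit onePlusEps⁻¹) LieHom.id

/-- The subspace `𝔤[[u]]` of `𝔤((u))`. -/
def taylorPart : Submodule ℂ (LaurentSeries ℂ ⊗[ℂ] 𝔤) :=
  LinearMap.range (LinearMap.rTensor 𝔤
    (HahnSeries.ofPowerSeriesAlg (A := ℂ) (R := ℂ) (Γ := ℤ)).toLinearMap)

/-! ### The two bilinear forms -/

/-- The form `Q_a (f₁, f₂) = Res_{u = 0} (a(u) K(f₁, f₂))` on `𝔤((u))`, where `K` is the Killing
form of `𝔤((u))` over `ℂ((u))`, and the residue is the coefficient of `u⁻¹`. -/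
def residueForm (a : LaurentSeries ℂ) : LinearMap.BilinForm ℂ (LaurentSeries ℂ ⊗[ℂ] 𝔤) :=
  LinearMap.mk₂ ℂ
    (fun f₁ f₂ ↦
      (a * killingForm (LaurentSeries ℂ) (LaurentSeries ℂ ⊗[ℂ] 𝔤) f₁ f₂).coeff (-1))
    (fun f₁ f₂ f₃ ↦ by simp [mul_add])
    (fun c f₁ f₂ ↦ by
      have h : killingForm (LaurentSeries ℂ) (LaurentSeries ℂ ⊗[ℂ] 𝔤) (c • f₁) f₂ =
          c • killingForm (LaurentSeries ℂ) (LaurentSeries ℂ ⊗[ℂ] 𝔤) f₁ f₂ := by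
        rw [← algebraMap_smul (LaurentSeries ℂ) c f₁, map_smul, LinearMap.smul_apply,
          algebraMap_smul]
      rw [h, mul_smul_comm, HahnSeries.coeff_smul])
    (fun f₁ f₂ f₃ ↦ by simp [mul_add])
    (fun c f₁ f₂ ↦ by
      have h : killingForm (LaurentSeries ℂ) (LaurentSeries ℂ ⊗[ℂ] 𝔤) f₁ (c • f₂) =
          c • killingForm (LaurentSeries ℂ) (LaurentSeries ℂ ⊗[ℂ] 𝔤) f₁ f₂ := by
        rw [← algebraMap_smul (LaurentSeries ℂ) c f₂, map_smul, smul_eq_mul, ← Algebra.smul_def]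
      rw [h, mul_smul_comm, HahnSeries.coeff_smul])

/-- The map `x₁ + ε x₂ ↦ x₁` from `𝔤[ε]` to `𝔤`. -/
def constPart : DualNumber ℂ ⊗[ℂ] 𝔤 →ₗ[ℂ] 𝔤 :=
  (TensorProduct.lid ℂ 𝔤).toLinearMap ∘ₗ LinearMap.rTensor 𝔤 (TrivSqZeroExt.fstHom ℂ ℂ ℂ).toLinearMap

/-- The map `x₁ + ε x₂ ↦ x₂` from `𝔤[ε]` to `𝔤`. -/
def epsPart : DualNumber ℂ ⊗[ℂ] 𝔤 →ₗ[ℂ] 𝔤 :=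
  (TensorProduct.lid ℂ 𝔤).toLinearMap ∘ₗ LinearMap.rTensor 𝔤 (TrivSqZeroExt.sndHom ℂ ℂ)

/-- The form `Q̄_ε (x₁ + ε x₂, y₁ + ε y₂) = K(x₁, y₂) + K(x₂, y₁)` on `𝔤[ε]`. -/
def epsForm : LinearMap.BilinForm ℂ (DualNumber ℂ ⊗[ℂ] 𝔤) :=
  (killingForm ℂ 𝔤).compl₁₂ (constPart 𝔤) (epsPart 𝔤) +
    (killingForm ℂ 𝔤).compl₁₂ (epsPart 𝔤) (constPart 𝔤)

variable {𝔤}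

/-- A Lie subalgebra is Lagrangian for a bilinear form if it is its own orthogonal complement. -/
def IsLagrangian {L : Type*} [LieRing L] [LieAlgebra ℂ L] (Q : LinearMap.BilinForm ℂ L)
    (W : LieSubalgebra ℂ L) : Prop :=
  Q.orthogonal W.toSubmodule = W.toSubmodule

/-! ### Roots, maximal orders and parabolic subalgebras -/

/-- The subspace `M ⊗ V` of `A ⊗ 𝔤`, for subspaces `M` of `A` and `V` of `𝔤`. -/
def tensorSub {A : Type*} [CommRing A] [Algebra ℂ A] (M : Submodule ℂ A) (V : Submodule ℂ 𝔤) :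
    Submodule ℂ (A ⊗[ℂ] 𝔤) :=
  Submodule.map₂ (TensorProduct.mk ℂ A 𝔤) M V

/-- The Laurent series `f = ∑ aₙ u⁻ⁿ` in `ℂ((u⁻¹))` of valuation `v(f) ≥ c`: the coefficient
of `u⁻ⁿ` vanishes for all `n < c`. -/
def valuationGE (c : ℝ) : Submodule ℂ (LaurentSeries ℂ) where
  carrier := {f | ∀ n : ℤ, (n : ℝ) < c → f.coeff n = 0}
  zero_mem' n _ := by simp
  add_mem' hf hg n hn := by simp [hf n hn, hg n hn]
  smul_mem' a f hf n hn := by simp [hf n hn]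

variable [FiniteDimensional ℂ 𝔤] [LieAlgebra.IsKilling ℂ 𝔤]
variable {H : LieSubalgebra ℂ 𝔤} [H.IsCartanSubalgebra]

variable (H) in
/-- The order `𝕆_h = 𝔥[[u⁻¹]] ⊕ ⨁_β M_β(h) ⊗ 𝔤_β` in `𝔤((u⁻¹))`, where
`M_β(h) = {f : v(f) ≥ β(h)}`; the variable of the Laurent series is `u⁻¹`. It is meant for those
`h` at which all roots take real values. -/
def maximalOrder (h : H) : Submodule ℂ (LaurentSeries ℂ ⊗[ℂ] 𝔤) :=
  tensorSub (valuationGE 0) H.toSubmodule ⊔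
    ⨆ β : H.root, tensorSub (valuationGE ((LieAlgebra.IsKilling.rootSystem H).root β h).re)
      (LieAlgebra.rootSpace H ((LieAlgebra.IsKilling.rootSystem H).root β)).toSubmodule

variable (b : (LieAlgebra.IsKilling.rootSystem H).Base)

/-- `θ` is the highest root: each difference `θ - β`, with `β` a root, is a sum of simple roots
with natural coefficients. -/
def IsHighestRoot (θ : H.root) : Prop :=
  ∀ β : H.root, ∃ c : b.support → ℕ,
    (LieAlgebra.IsKilling.rootSystem H).root θ - (LieAlgebra.IsKilling.rootSystem H).root β =
      ∑ j : b.support, c j • (LieAlgebra.IsKilling.rootSystem H).root j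

/-- The element `h` of the Cartan subalgebra with `α(h) = 1 / k`, at which all simple roots other
than `α` vanish. When `k` is the coefficient of `α` in the highest root, this is the vertex of the
standard simplex that corresponds to `α`. -/
def vertex (α : b.support) (k : ℕ) : H :=
  (k : ℂ)⁻¹ • (Module.evalEquiv ℂ H).symm (b.toWeightBasis.coord α)

open Classical in
theorem root_vertex (α j : b.support) (k : ℕ) :
    (LieAlgebra.IsKilling.rootSystem H).root j (vertex b α k) = if j = α then (k : ℂ)⁻¹ else 0 := by
  rw [vertex, map_smul, Module.apply_evalEquiv_symm_apply, Module.Basis.coord_apply,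
    RootPairing.Base.toWeightBasis_repr_root, Finsupp.single_apply]
  split_ifs <;> simp

/-- The subspace `𝕆_h ∩ 𝔤[u, u⁻¹]`, as a subspace of `𝔤((u))`. The intersection is taken
in `𝔤((u⁻¹))`. -/
def orderLaurent (h : H) : Submodule ℂ (LaurentSeries ℂ ⊗[ℂ] 𝔤) :=
  ((maximalOrder H h).comap (toLaurentAtInfty 𝔤 : ℂ[T;T⁻¹] ⊗[ℂ] 𝔤 →ₗ[ℂ] _)).map
    (toLaurentAtZero 𝔤 : ℂ[T;T⁻¹] ⊗[ℂ] 𝔤 →ₗ[ℂ] _)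

/-- The standard parabolic subalgebra `P_α⁻`, spanned by the Cartan subalgebra and the root spaces
of all negative roots and of all positive roots in which `α` has coefficient `0`. -/
def parabolicNeg (α : b.support) : Submodule ℂ 𝔤 :=
  H.toSubmodule ⊔
    ⨆ β : {β : H.root // ¬ b.IsPos β ∨
        b.toWeightBasis.repr ((LieAlgebra.IsKilling.rootSystem H).root β) α = 0},
      (LieAlgebra.rootSpace H ((LieAlgebra.IsKilling.rootSystem H).root β)).toSubmodule

/-- The subspace `P_α⁻ + ε (P_α⁻)^⊥` of `𝔤[ε]`, the orthogonal complement being that for the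
Killing form of `𝔤`. -/
def parabolicEps (α : b.support) : Submodule ℂ (DualNumber ℂ ⊗[ℂ] 𝔤) :=
  (parabolicNeg b α).map (TensorProduct.mk ℂ (DualNumber ℂ) 𝔤 1) ⊔
    ((killingForm ℂ 𝔤).orthogonal (parabolicNeg b α)).map
      (TensorProduct.mk ℂ (DualNumber ℂ) 𝔤 DualNumber.eps)

/-! ### The two families of Lagrangian subalgebras -/

/-- The Laurent series `a(u) = 1 / (1 - u)²`. -/
def aSeries : LaurentSeries ℂ := 1 / (1 - (laurentVar : LaurentSeries ℂ)) ^ 2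

/-- The Lagrangian subalgebras `W` of `𝔤((u))` for the form `Q_{a(u)}`, `a(u) = 1 / (1 - u)²`, that
are transversal to `𝔤[[u]]` and contained in `𝕆_α ∩ 𝔤[u, u⁻¹]`, for the simple root `α` of
coefficient `k` in the highest root. -/
def lagrangiansInOrder (α : b.support) (k : ℕ) :
    Set (LieSubalgebra ℂ (LaurentSeries ℂ ⊗[ℂ] 𝔤)) :=
  {W | IsLagrangian (residueForm 𝔤 aSeries) W ∧ IsCompl W.toSubmodule (taylorPart 𝔤) ∧
    W.toSubmodule ≤ orderLaurent (vertex b α k)}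

/-- The Lagrangian subalgebras of `𝔤[ε]` for the form `Q̄_ε` that are transversal
to `P_α⁻ + ε (P_α⁻)^⊥`. -/
def lagrangiansEps (α : b.support) : Set (LieSubalgebra ℂ (DualNumber ℂ ⊗[ℂ] 𝔤)) :=
  {V | IsLagrangian (epsForm 𝔤) V ∧ IsCompl V.toSubmodule (parabolicEps b α)}

/-- The image in `𝔤[ε]` of `W ∩ 𝔤[u, u⁻¹]` under the evaluation at `u⁻¹ = 1 + ε`. -/
def evalSubalgebra (W : LieSubalgebra ℂ (LaurentSeries ℂ ⊗[ℂ] 𝔤)) :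
    LieSubalgebra ℂ (DualNumber ℂ ⊗[ℂ] 𝔤) :=
  (W.comap (toLaurentAtZero 𝔤)).map (evalEps 𝔤)

end LieBialg

end

/-! Write `h` for `h_α` and `O` for `𝕆_α ∩ 𝔤[u, u⁻¹]`. In a basis of root vectors, `O` is given
coordinate by coordinate: the coordinate along a vector of weight `χ` has valuation at least `χ(h)`
at infinity. The numbers `χ(h)` grade `𝔤`; the bracket adds degrees and the Killing form `K` pairs
only opposite ones.

Let `k = 1`. All degrees lie in `{-1, 0, 1}`, so `O` is a subalgebra on which `K` takes values in
`ℂ[u⁻¹]`. On `ℂ[u⁻¹]`, the residue against `a(u)` is the `ε`-coefficient of the value at `u = 1 - ε`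
(`coeff_aSeries_mul`). Hence `Q_a` on `O` is pulled back from `Q̄_ε` along the surjection `E : O →
𝔤[ε]`. The kernel of `E` is orthogonal to `O`, so it lies in every Lagrangian `W ⊆ O`; conversely
its orthogonal complement lies in `O` (`exists_mem_gradedOrder_of_orthogonal`). Thus Lagrangian
subalgebras inside `O` are the preimages of those of `𝔤[ε]`. Transversality carries over because `O
+ 𝔤[[u]]` is everything (degrees at most `1`) and `E` maps `O ∩ 𝔤[[u]]` isomorphically onto `P_α⁻ +
ε (P_α⁻)^⊥` (degrees at least `-1`). The formal part of this is `bijOn_lagrangian`.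

Let `k > 1`. Now `±α(h) = ±1/k` is not an integer, while Laurent polynomials have integral
valuations. The coordinates of `O` along `𝔤_α` therefore have valuation at least `1`, so `(u⁻¹ - 1)²
u ⊗ 𝔤_{-α}` is orthogonal to `O` and would lie in any Lagrangian `W ⊆ O`; but its valuation `-1` is
below `-1/k`. -/

open scoped TensorProduct LaurentPolynomial

noncomputable section

namespace LieBialg

open Module LieAlgebra LieAlgebra.IsKilling

/-! ### Coordinates in `A ⊗ 𝔤` -/

section Coordinates

variable {ι 𝔤 : Type*} [Fintype ι] [LieRing 𝔤] [LieAlgebra ℂ 𝔤] (e : Basis ι ℂ 𝔤)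
  (A : Type*) [CommRing A] [Algebra ℂ A]

/-- The coordinates of an element of `A ⊗ 𝔤` in a basis of `𝔤`. -/
def coords : A ⊗[ℂ] 𝔤 ≃ₗ[A] (ι → A) := (Algebra.TensorProduct.basis A e).equivFun

variable {A}

@[simp]
theorem coords_tmul (a : A) (x : 𝔤) (i : ι) : coords e A (a ⊗ₜ x) i = e.repr x i • a := by
  simp [coords, Basis.equivFun_apply, Algebra.TensorProduct.basis_repr_tmul, Algebra.smul_def,
    mul_comm]

theorem coords_tmul_eq_zero (a : A) {x : 𝔤} {i : ι} (h : e.repr x i = 0) :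
    coords e A (a ⊗ₜ x) i = 0 := by
  rw [coords_tmul, h, zero_smul]

theorem coords_smul (c : ℂ) (f : A ⊗[ℂ] 𝔤) (i : ι) : coords e A (c • f) i = c • coords e A f i := by
  rw [← algebraMap_smul A c f, map_smul, Pi.smul_apply, algebraMap_smul]

theorem coords_ext {f g : A ⊗[ℂ] 𝔤} (h : ∀ i, coords e A f i = coords e A g i) : f = g :=
  (coords e A).injective (funext h)

theorem sum_coords_tmul (f : A ⊗[ℂ] 𝔤) : ∑ i, coords e A f i ⊗ₜ e i = f := by
  classical
  refine coords_ext e fun j ↦ ?_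
  simp [map_sum, Finset.sum_apply, Finsupp.single_apply]

theorem exists_coords_eq (a : ι → A) : ∃ f : A ⊗[ℂ] 𝔤, ∀ i, coords e A f i = a i :=
  ⟨(coords e A).symm a, fun i ↦ by simp⟩

@[simp]
theorem coords_map {B : Type*} [CommRing B] [Algebra ℂ B] (φ : A →ₐ[ℂ] B) (f : A ⊗[ℂ] 𝔤) (i : ι) :
    coords e B (LieAlgebra.ExtendScalars.map φ LieHom.id f) i = φ (coords e A f i) := by
  induction f using TensorProduct.induction_on with
  | zero => simp
  | tmul a x =>
    rw [show LieAlgebra.ExtendScalars.map φ LieHom.id (a ⊗ₜ[ℂ] x) = φ a ⊗ₜ x from rfl]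
    simp
  | add f g hf hg => simp [hf, hg]

theorem baseChange_eq_sum (K : LinearMap.BilinForm ℂ 𝔤) (f g : A ⊗[ℂ] 𝔤) :
    K.baseChange A f g = ∑ i, ∑ j, K (e i) (e j) • (coords e A f i * coords e A g j) := by
  conv_lhs => rw [← sum_coords_tmul e f, ← sum_coords_tmul e g]
  simp [map_sum, LinearMap.sum_apply, LinearMap.BilinForm.baseChange_tmul]
  rw [Finset.sum_comm]

theorem baseChange_map {B : Type*} [CommRing B] [Algebra ℂ B] (φ : A →ₐ[ℂ] B)
    (K : LinearMap.BilinForm ℂ 𝔤) (f g : A ⊗[ℂ] 𝔤) :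
    K.baseChange B (LieAlgebra.ExtendScalars.map φ LieHom.id f)
      (LieAlgebra.ExtendScalars.map φ LieHom.id g) = φ (K.baseChange A f g) := by
  induction f using TensorProduct.induction_on with
  | zero => simp
  | add f f' hf hf' => simp [hf, hf']
  | tmul a x =>
    induction g using TensorProduct.induction_on with
    | zero => simp
    | add f f' hf hf' => rw [map_add, map_add, hf, hf', map_add, map_add]
    | tmul b y =>
      change K.baseChange B (φ a ⊗ₜ[ℂ] x) (φ b ⊗ₜ[ℂ] y) = _
      simp [LinearMap.BilinForm.baseChange_tmul]

theorem coords_lie (f g : A ⊗[ℂ] 𝔤) (l : ι) :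
    coords e A ⁅f, g⁆ l =
      ∑ i, ∑ j, e.repr ⁅e i, e j⁆ l • (coords e A f i * coords e A g j) := by
  conv_lhs => rw [← sum_coords_tmul e f, ← sum_coords_tmul e g]
  simp only [map_sum, Finset.sum_apply, LieAlgebra.ExtendScalars.bracket_tmul, coords_tmul,
    sum_lie, lie_sum]
  exact Finset.sum_comm

end Coordinates

/-! ### Both forms as functionals of the base-changed Killing form -/

section Forms

variable {𝔤 : Type*} [LieRing 𝔤] [LieAlgebra ℂ 𝔤]

theorem epsForm_apply (x y : DualNumber ℂ ⊗[ℂ] 𝔤) :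
    epsForm 𝔤 x y = ((killingForm ℂ 𝔤).baseChange (DualNumber ℂ) x y).snd := by
  induction x using TensorProduct.induction_on with
  | zero => simp
  | add f f' hf hf' => simp [hf, hf']
  | tmul a x =>
    induction y using TensorProduct.induction_on with
    | zero => simp
    | add f f' hf hf' => simp [hf, hf']
    | tmul b y =>
      rw [LinearMap.BilinForm.baseChange_tmul]
      simp [epsForm, constPart, epsPart]
      ring

theorem residueForm_apply [FiniteDimensional ℂ 𝔤] (a : LaurentSeries ℂ)
    (x y : LaurentSeries ℂ ⊗[ℂ] 𝔤) : residueForm 𝔤 a x y =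
      (a * (killingForm ℂ 𝔤).baseChange (LaurentSeries ℂ) x y).coeff (-1) := by
  rw [← show killingForm (LaurentSeries ℂ) (LaurentSeries ℂ ⊗[ℂ] 𝔤) =
    (killingForm ℂ 𝔤).baseChange (LaurentSeries ℂ) from LieModule.traceForm_baseChange ..]
  rfl

end Forms

/-! ### Laurent polynomials, the residue and evaluation at `u = 1 - ε` -/

section Laurent

theorem substUnit_single {A : Type*} [CommRing A] [Algebra ℂ A] (x : Aˣ) (c : ℂ) (m : ℤ) :
    substUnit x (AddMonoidAlgebra.single m c) = c • ((x ^ m : Aˣ) : A) := by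
  rw [LaurentPolynomial.single_eq_C_mul_T, map_mul, Algebra.smul_def]
  change LaurentPolynomial.eval₂ _ _ _ * LaurentPolynomial.eval₂ _ _ _ = _
  rw [LaurentPolynomial.eval₂_C, LaurentPolynomial.eval₂_T]

theorem laurentVar_zpow (m : ℤ) :
    ((laurentVar ^ m : (LaurentSeries ℂ)ˣ) : LaurentSeries ℂ) = HahnSeries.single m 1 := by
  have h (n : ℕ) : ((laurentVar ^ n : (LaurentSeries ℂ)ˣ) : LaurentSeries ℂ) =
      HahnSeries.single (n : ℤ) 1 := by
    simp [laurentVar, HahnSeries.single_pow]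
  obtain ⟨n, rfl | rfl⟩ := m.eq_nat_or_neg
  · simpa using h n
  · rw [zpow_neg, zpow_natCast, ← inv_pow, Units.val_pow_eq_pow_val]
    change (HahnSeries.single (-1) (1 : ℂ)) ^ n = _
    simp [HahnSeries.single_pow]

theorem onePlusEps_inv_zpow (m : ℤ) :
    ((onePlusEps⁻¹ ^ m : (DualNumber ℂ)ˣ) : DualNumber ℂ) = 1 - (m : ℂ) • DualNumber.eps := by
  have hval : ((onePlusEps⁻¹ : (DualNumber ℂ)ˣ) : DualNumber ℂ) = 1 - DualNumber.eps := rfl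
  have hinv : ((onePlusEps : (DualNumber ℂ)ˣ) : DualNumber ℂ) = 1 + DualNumber.eps := rfl
  induction m using Int.induction_on with
  | zero => simp
  | succ n ih =>
    rw [zpow_add_one, Units.val_mul, ih, hval]
    ext <;> simp
  | pred n ih =>
    rw [zpow_sub_one, Units.val_mul, ih, inv_inv, hinv]
    ext <;> simp

theorem coeff_substUnit_laurentVar (f : ℂ[T;T⁻¹]) (m : ℤ) :
    (substUnit laurentVar f).coeff m = f.coeff m := by
  induction f using AddMonoidAlgebra.induction_linear with
  | zero => simp
  | add f g hf hg => simp [hf, hg]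
  | single n c =>
    rw [substUnit_single, laurentVar_zpow]
    rw [AddMonoidAlgebra.coeff_single, Finsupp.single_apply]
    simp [HahnSeries.coeff_single, eq_comm]

theorem coeff_substUnit_laurentVar_inv (f : ℂ[T;T⁻¹]) (m : ℤ) :
    (substUnit laurentVar⁻¹ f).coeff m = f.coeff (-m) := by
  induction f using AddMonoidAlgebra.induction_linear with
  | zero => simp
  | add f g hf hg => simp [hf, hg]
  | single n c =>
    rw [substUnit_single, inv_zpow', laurentVar_zpow]
    simp only [HahnSeries.coeff_smul, HahnSeries.coeff_single, AddMonoidAlgebra.coeff_single,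
      Finsupp.single_apply]
    simp only [show m = -n ↔ n = -m by omega]
    simp

/-- The support of a Laurent series is bounded below, so a bound above makes it finite. -/
theorem exists_substUnit_eq_of_coeff_eq_zero (y : LaurentSeries ℂ) (N : ℤ)
    (hy : ∀ m, N < m → y.coeff m = 0) : ∃ f : ℂ[T;T⁻¹], substUnit laurentVar f = y := by
  have hfin : (Function.support y.coeff).Finite := by
    refine (Set.finite_Icc y.order N).subset fun m hm ↦ ⟨?_, ?_⟩
    · exact HahnSeries.order_le_of_coeff_ne_zero hm
    · exact not_lt.mp fun h ↦ hm (hy m h)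
  refine ⟨.ofCoeff (Finsupp.ofSupportFinite _ hfin), ?_⟩
  ext m
  rw [coeff_substUnit_laurentVar]
  rfl

theorem aSeries_mul_one_sub_sq : aSeries * (1 - (laurentVar : LaurentSeries ℂ)) ^ 2 = 1 := by
  refine one_div_mul_cancel (pow_ne_zero 2 fun h ↦ ?_)
  have := congr_arg (fun f : LaurentSeries ℂ ↦ f.coeff 0) h
  simp [laurentVar] at this

theorem aSeries_eq :
    aSeries = HahnSeries.ofPowerSeries ℤ ℂ (PowerSeries.mk fun n ↦ (n : ℂ) + 1) := by
  have h1 : (1 - (laurentVar : LaurentSeries ℂ)) =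
      HahnSeries.ofPowerSeries ℤ ℂ (1 - PowerSeries.X) := by
    rw [map_sub, map_one, HahnSeries.ofPowerSeries_X]
    rfl
  have h2 : (PowerSeries.mk fun n ↦ (n : ℂ) + 1) * (1 - PowerSeries.X) ^ 2 = 1 := by
    have h3 : (PowerSeries.mk fun n ↦ (n : ℂ) + 1) * (1 - PowerSeries.X) = PowerSeries.mk 1 := by
      ext n
      cases n <;> simp [mul_sub, PowerSeries.coeff_succ_mul_X]
    rw [pow_two, ← mul_assoc, h3, PowerSeries.mk_one_mul_one_sub_eq_one]
  refine mul_right_cancel₀ (right_ne_zero_of_mul_eq_one aSeries_mul_one_sub_sq) ?_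
  rw [aSeries_mul_one_sub_sq, h1, ← map_pow, ← map_mul, h2, map_one]

theorem ofPowerSeries_coeff_of_neg (p : PowerSeries ℂ) {m : ℤ} (hm : m < 0) :
    (HahnSeries.ofPowerSeries ℤ ℂ p).coeff m = 0 := by
  rw [HahnSeries.ofPowerSeries_apply, HahnSeries.embDomain_of_notMem_range]
  rintro ⟨n, rfl⟩
  exact absurd hm (by simp)

/-- Since `a(u) = ∑ (n + 1) uⁿ`, the residue of `a(u) uᵐ` is `-m` for `m ≤ 0`, which is also the
`ε`-coefficient of `(1 - ε)ᵐ`. For `m > 0` the residue is `0` and the two differ. -/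
theorem coeff_aSeries_mul (f : ℂ[T;T⁻¹]) (hf : ∀ m, 0 < m → f.coeff m = 0) :
    (aSeries * substUnit laurentVar f).coeff (-1) = (substUnit onePlusEps⁻¹ f).snd := by
  have h (f : ℂ[T;T⁻¹]) : (aSeries * substUnit laurentVar f).coeff (-1) =
      f.coeff.sum fun m c ↦ c * aSeries.coeff (-1 - m) := by
    induction f using AddMonoidAlgebra.induction_linear with
    | zero => simp
    | add f g hf hg =>
      rw [map_add, mul_add, HahnSeries.coeff_add, hf, hg, AddMonoidAlgebra.coeff_add,
        Finsupp.sum_add_index'] <;> simp [add_mul]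
    | single n c =>
      rw [substUnit_single, laurentVar_zpow, mul_smul_comm]
      rw [AddMonoidAlgebra.coeff_single, Finsupp.sum_single_index (by simp)]
      simp [HahnSeries.coeff_mul_single]
  have h' (f : ℂ[T;T⁻¹]) : (substUnit onePlusEps⁻¹ f).snd =
      f.coeff.sum fun m c ↦ c * (-m : ℂ) := by
    induction f using AddMonoidAlgebra.induction_linear with
    | zero => simp
    | add f g hf hg =>
      rw [map_add, TrivSqZeroExt.snd_add, hf, hg, AddMonoidAlgebra.coeff_add,
        Finsupp.sum_add_index'] <;> simp [add_mul]; grind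
    | single n c =>
      rw [substUnit_single, onePlusEps_inv_zpow, AddMonoidAlgebra.coeff_single,
        Finsupp.sum_single_index (by simp)]
      simp
  rw [h, h']
  refine Finsupp.sum_congr fun m hm ↦ ?_
  have hm0 : m ≤ 0 := not_lt.mp fun h0 ↦ Finsupp.mem_support_iff.mp hm (hf m h0)
  congr 1
  rw [aSeries_eq]
  rcases hm0.lt_or_eq with hm0 | rfl
  · obtain ⟨n, hn⟩ : ∃ n : ℕ, -1 - m = n := ⟨(-1 - m).toNat, by omega⟩
    rw [hn, HahnSeries.ofPowerSeries_apply_coeff, PowerSeries.coeff_mk,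
      show m = -1 - (n : ℤ) by omega]
    push_cast
    ring
  -- For `m = 0` the coefficient of `u⁻¹` in `a(u)` is meant; it vanishes and agrees with `-m = 0`.
  · rw [ofPowerSeries_coeff_of_neg _ (by simp)]
    simp

end Laurent

/-! ### Lagrangian subalgebras under reduction modulo a radical -/

section Correspondence

variable {X Y Z : Type*} [LieRing X] [LieAlgebra ℂ X] [LieRing Y] [LieAlgebra ℂ Y]
  [LieRing Z] [LieAlgebra ℂ Z]

theorem isCompl_iff_forall {V : Type*} [AddCommGroup V] [Module ℂ V] (p q : Submodule ℂ V) :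
    IsCompl p q ↔ (∀ x ∈ p, x ∈ q → x = 0) ∧ ∀ z, ∃ x ∈ p, ∃ y ∈ q, x + y = z := by
  rw [isCompl_iff, Submodule.disjoint_def, codisjoint_iff, Submodule.eq_top_iff']
  simp only [Submodule.mem_sup]

theorem isLagrangian_iff (Q : LinearMap.BilinForm ℂ X) (W : LieSubalgebra ℂ X) :
    IsLagrangian Q W ↔ ∀ x, (∀ w ∈ W, Q w x = 0) ↔ x ∈ W := by
  rw [IsLagrangian, SetLike.ext_iff]
  rfl

/-- Lagrangian subalgebras inside an order `O` of `Y` correspond to Lagrangian subalgebras of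
the quotient `Z` of `O` by the radical of the form. -/
theorem bijOn_lagrangian (ι : X →ₗ⁅ℂ⁆ Y) (E : X →ₗ⁅ℂ⁆ Z) (hι : Function.Injective ι)
    (O : Submodule ℂ X) (hO : ∀ f ∈ O, ∀ g ∈ O, ⁅f, g⁆ ∈ O)
    (QY : LinearMap.BilinForm ℂ Y) (QZ : LinearMap.BilinForm ℂ Z)
    (T : Submodule ℂ Y) (P : Submodule ℂ Z)
    (hQ : ∀ f ∈ O, ∀ g ∈ O, QY (ι f) (ι g) = QZ (E f) (E g))
    (hE : ∀ z, ∃ f ∈ O, E f = z)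
    (hperp : ∀ y, (∀ f ∈ O, E f = 0 → QY (ι f) y = 0) → ∃ f ∈ O, ι f = y)
    (hsum : ∀ y, ∃ f ∈ O, ∃ p ∈ T, ι f + p = y)
    (hTP : ∀ f ∈ O, ι f ∈ T → E f ∈ P)
    (hTinj : ∀ f ∈ O, ι f ∈ T → E f = 0 → f = 0)
    (hTsurj : ∀ p ∈ P, ∃ f ∈ O, ι f ∈ T ∧ E f = p) :
    Set.BijOn (fun W : LieSubalgebra ℂ Y ↦ (W.comap ι).map E)
      {W | IsLagrangian QY W ∧ IsCompl W.toSubmodule T ∧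
        W.toSubmodule ≤ O.map (ι : X →ₗ[ℂ] Y)}
      {V | IsLagrangian QZ V ∧ IsCompl V.toSubmodule P} := by
  have memO {W : LieSubalgebra ℂ Y} (hW : W.toSubmodule ≤ O.map (ι : X →ₗ[ℂ] Y)) (f : X)
      (hf : ι f ∈ W) : f ∈ O := by
    obtain ⟨g, hg, hgf⟩ := hW hf
    rwa [← hι hgf]
  have lift {W : LieSubalgebra ℂ Y} (hW : W.toSubmodule ≤ O.map (ι : X →ₗ[ℂ] Y)) (w : Y)
      (hw : w ∈ W) : ∃ f ∈ O, ι f = w := hW hw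
  have mem_map (W : LieSubalgebra ℂ Y) (v : Z) :
      v ∈ (W.comap ι).map E ↔ ∃ f, ι f ∈ W ∧ E f = v := by
    rw [LieSubalgebra.mem_map]
    rfl
  -- By `hQ`, the kernel of `E` on `O` is orthogonal to `O`, hence to `W`, and `W` is its own
  -- complement.
  have hker {W : LieSubalgebra ℂ Y} (hL : IsLagrangian QY W)
      (hW : W.toSubmodule ≤ O.map (ι : X →ₗ[ℂ] Y)) (f : X) (hf : f ∈ O) (hEf : E f = 0) :
      ι f ∈ W := by
    rw [isLagrangian_iff] at hL
    refine (hL _).mp fun w hw ↦ ?_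
    obtain ⟨g, hg, rfl⟩ := lift hW w hw
    rw [hQ g hg f hf, hEf, map_zero]
  refine ⟨?_, ?_, ?_⟩
  · rintro W ⟨hL, hc, hW⟩
    have hk := hker hL hW
    rw [isLagrangian_iff] at hL
    rw [isCompl_iff_forall] at hc
    refine ⟨(isLagrangian_iff _ _).mpr fun z ↦ ⟨fun hz ↦ ?_, fun hz v hv ↦ ?_⟩,
      (isCompl_iff_forall _ _).mpr ⟨fun x hx hxP ↦ ?_, fun z ↦ ?_⟩⟩
    · obtain ⟨f, hf, rfl⟩ := hE z
      rw [mem_map]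
      refine ⟨f, (hL _).mp fun w hw ↦ ?_, rfl⟩
      obtain ⟨g, hg, rfl⟩ := lift hW w hw
      rw [hQ g hg f hf]
      exact hz _ ((mem_map _ _).mpr ⟨g, hw, rfl⟩)
    · rw [mem_map] at hz hv
      obtain ⟨f, hf, rfl⟩ := hz
      obtain ⟨g, hg, rfl⟩ := hv
      rw [← hQ g (memO hW g hg) f (memO hW f hf)]
      exact (hL _).mpr hf _ hg
    · obtain ⟨f, hf, rfl⟩ := (mem_map _ _).mp hx
      -- The lift `p` in `T` differs from `f` by an element of the kernel, so it lies in `W ∩ T =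
      -- 0`.
      obtain ⟨p, hp, hpT, hpf⟩ := hTsurj _ hxP
      have h1 : ι (f - p) ∈ W := hk _ (sub_mem (memO hW f hf) hp) (by simp [hpf])
      have h2 : ι p ∈ W := by
        have := sub_mem hf h1
        rwa [map_sub, sub_sub_cancel] at this
      have h3 : ι p = 0 := hc.1 _ h2 hpT
      rw [← hpf, hι (h3.trans (map_zero ι).symm), map_zero]
    · obtain ⟨f, hf, rfl⟩ := hE z
      obtain ⟨w, hw, p, hp, hwp⟩ := hc.2 (ι f)
      obtain ⟨g, hg, rfl⟩ := lift hW w hw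
      refine ⟨E g, (mem_map _ _).mpr ⟨g, hw, rfl⟩, E (f - g), hTP _ (sub_mem hf hg) ?_, ?_⟩
      · rwa [map_sub, ← hwp, add_sub_cancel_left]
      · simp
  · have key {W W' : LieSubalgebra ℂ Y} (hW : W.toSubmodule ≤ O.map (ι : X →ₗ[ℂ] Y))
        (hL' : IsLagrangian QY W') (hW' : W'.toSubmodule ≤ O.map (ι : X →ₗ[ℂ] Y))
        (h : (W.comap ι).map E = (W'.comap ι).map E) : W ≤ W' := by
      intro w hw
      obtain ⟨f, hf, rfl⟩ := lift hW w hw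
      have h1 : E f ∈ (W'.comap ι).map E := h ▸ (mem_map _ _).mpr ⟨f, hw, rfl⟩
      obtain ⟨g, hg, hgf⟩ := (mem_map _ _).mp h1
      have h2 : ι (f - g) ∈ W' := hker hL' hW' _ (sub_mem hf (memO hW' g hg)) (by simp [hgf])
      have := add_mem h2 hg
      rwa [map_sub, sub_add_cancel] at this
    rintro W ⟨hL, -, hW⟩ W' ⟨hL', -, hW'⟩ h
    exact le_antisymm (key hW hL' hW' h) (key hW' hL hW h.symm)
  · rintro V ⟨hL, hc⟩
    rw [isLagrangian_iff] at hL
    rw [isCompl_iff_forall] at hc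
    let OL : LieSubalgebra ℂ X := { O with lie_mem' := fun hf hg ↦ hO _ hf _ hg }
    -- The inverse correspondence takes the full preimage of `V` in `O`.
    let W : LieSubalgebra ℂ Y := (OL ⊓ V.comap E).map ι
    have mem_W (y : Y) : y ∈ W ↔ ∃ f ∈ O, E f ∈ V ∧ ι f = y := by
      rw [LieSubalgebra.mem_map]
      constructor
      · rintro ⟨f, ⟨h1, h2⟩, h3⟩
        exact ⟨f, h1, h2, h3⟩
      · rintro ⟨f, h1, h2, h3⟩
        exact ⟨f, ⟨h1, h2⟩, h3⟩
    have mem_W' (f : X) : ι f ∈ W ↔ f ∈ O ∧ E f ∈ V := by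
      rw [mem_W]
      constructor
      · rintro ⟨g, h1, h2, h3⟩
        rw [← hι h3]
        exact ⟨h1, h2⟩
      · exact fun h ↦ ⟨f, h.1, h.2, rfl⟩
    refine ⟨W, ⟨(isLagrangian_iff _ _).mpr fun y ↦ ⟨fun hy ↦ ?_, fun hy w hw ↦ ?_⟩,
      (isCompl_iff_forall _ _).mpr ⟨fun y hy hyT ↦ ?_, fun y ↦ ?_⟩, fun y hy ↦ ?_⟩, ?_⟩
    -- The preimage contains the kernel of `E`, so by `hperp` anything orthogonal to it comes from
    -- `O`.
    · obtain ⟨f, hf, rfl⟩ := hperp y fun f hf hEf ↦ hy _ <| (mem_W' f).mpr ⟨hf, by simp [hEf]⟩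
      refine (mem_W' f).mpr ⟨hf, (hL _).mp fun v hv ↦ ?_⟩
      obtain ⟨g, hg, rfl⟩ := hE v
      rw [← hQ g hg f hf]
      exact hy _ ((mem_W' g).mpr ⟨hg, hv⟩)
    · obtain ⟨f, hf, hfV, rfl⟩ := (mem_W _).mp hy
      obtain ⟨g, hg, hgV, rfl⟩ := (mem_W _).mp hw
      rw [hQ g hg f hf]
      exact (hL _).mpr hfV _ hgV
    · obtain ⟨f, hf, hfV, rfl⟩ := (mem_W _).mp hy
      rw [hTinj f hf hyT (hc.1 _ hfV (hTP f hf hyT)), map_zero]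
    · obtain ⟨f, hf, p, hp, rfl⟩ := hsum y
      -- The `P`-component of `E f` lifts to `O ∩ T` and is moved from the first summand to the
      -- second.
      obtain ⟨v, hv, q, hq, hvq⟩ := hc.2 (E f)
      obtain ⟨g, hg, hgT, rfl⟩ := hTsurj q hq
      refine ⟨ι (f - g), (mem_W' _).mpr ⟨sub_mem hf hg, ?_⟩, ι g + p, add_mem hgT hp, ?_⟩
      · rwa [map_sub, ← hvq, add_sub_cancel_right]
      · rw [map_sub]
        abel
    · obtain ⟨f, hf, -, rfl⟩ := (mem_W _).mp hy
      exact ⟨f, hf, rfl⟩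
    · ext v
      rw [mem_map]
      constructor
      · rintro ⟨f, hf, rfl⟩
        exact ((mem_W' f).mp hf).2
      · intro hv
        obtain ⟨f, hf, rfl⟩ := hE v
        exact ⟨f, (mem_W' f).mpr ⟨hf, hv⟩, rfl⟩

end Correspondence

/-! ### Orders in the loop algebra defined by a grading -/

section GradedOrder

/-- The Laurent polynomials in `u` of valuation at least `c` at infinity. -/
def valuationInftyGE (c : ℝ) : Submodule ℂ ℂ[T;T⁻¹] where
  carrier := {f | ∀ m : ℤ, -(m : ℝ) < c → f.coeff m = 0}
  zero_mem' n _ := by simp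
  add_mem' hf hg n hn := by simp [hf n hn, hg n hn]
  smul_mem' a f hf n hn := by simp [hf n hn]

theorem mul_mem_valuationInftyGE {c d : ℝ} {f g : ℂ[T;T⁻¹]} (hf : f ∈ valuationInftyGE c)
    (hg : g ∈ valuationInftyGE d) : f * g ∈ valuationInftyGE (c + d) := by
  classical
  intro m hm
  by_contra h
  obtain ⟨a, ha, b, hb, rfl⟩ := Finset.mem_add.mp
    (AddMonoidAlgebra.support_coeff_mul_subset f g (Finsupp.mem_support_iff.mpr h))
  have h1 := mt (hf a) (Finsupp.mem_support_iff.mp ha)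
  have h2 := mt (hg b) (Finsupp.mem_support_iff.mp hb)
  push_cast at hm
  linarith

theorem single_mem_valuationInftyGE {c : ℝ} {m : ℤ} (hm : c ≤ -m) (a : ℂ) :
    (.single m a : ℂ[T;T⁻¹]) ∈ valuationInftyGE c := by
  intro n hn
  rw [AddMonoidAlgebra.coeff_single, Finsupp.single_apply, if_neg]
  rintro rfl
  linarith

theorem valuationInftyGE_anti {c d : ℝ} (h : c ≤ d) : valuationInftyGE d ≤ valuationInftyGE c :=
  fun _ hf m hm ↦ hf m (hm.trans_le h)

theorem substUnit_laurentVar_inv_mem_valuationGE_iff {c : ℝ} {f : ℂ[T;T⁻¹]} :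
    substUnit laurentVar⁻¹ f ∈ valuationGE c ↔ f ∈ valuationInftyGE c := by
  refine ⟨fun h m hm ↦ ?_, fun h n hn ↦ ?_⟩
  · have := h (-m) (by exact_mod_cast hm)
    rwa [coeff_substUnit_laurentVar_inv, neg_neg] at this
  · rw [coeff_substUnit_laurentVar_inv]
    exact h _ (by simpa using hn)

variable {ι 𝔤 : Type*} [Fintype ι] [LieRing 𝔤] [LieAlgebra ℂ 𝔤] (e : Basis ι ℂ 𝔤) (r : ι → ℝ)

/-- The elements of the loop algebra whose `i`-th coordinate has valuation at least `r i`
at infinity. -/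
def gradedOrder : Submodule ℂ (ℂ[T;T⁻¹] ⊗[ℂ] 𝔤) where
  carrier := {f | ∀ i, coords e ℂ[T;T⁻¹] f i ∈ valuationInftyGE (r i)}
  zero_mem' i := by simp
  add_mem' hf hg i := by simpa using add_mem (hf i) (hg i)
  smul_mem' a f hf i := by
    rw [coords_smul]
    exact Submodule.smul_mem _ _ (hf i)

variable {e r}

theorem mem_gradedOrder {f : ℂ[T;T⁻¹] ⊗[ℂ] 𝔤} :
    f ∈ gradedOrder e r ↔ ∀ i, coords e ℂ[T;T⁻¹] f i ∈ valuationInftyGE (r i) := Iff.rfl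

theorem lie_mem_gradedOrder (hr : ∀ i j l, e.repr ⁅e i, e j⁆ l ≠ 0 → r l = r i + r j)
    {f g : ℂ[T;T⁻¹] ⊗[ℂ] 𝔤} (hf : f ∈ gradedOrder e r) (hg : g ∈ gradedOrder e r) :
    ⁅f, g⁆ ∈ gradedOrder e r := by
  intro l
  rw [coords_lie]
  refine sum_mem fun i _ ↦ sum_mem fun j _ ↦ ?_
  by_cases h : e.repr ⁅e i, e j⁆ l = 0
  · simp [h]
  · rw [hr i j l h]
    exact Submodule.smul_mem _ _ (mul_mem_valuationInftyGE (hf i) (hg j))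

/-- Only coordinates of opposite degrees are paired, and their valuation bounds add up to `0`. -/
theorem baseChange_mem_valuationInftyGE {K : LinearMap.BilinForm ℂ 𝔤}
    (hK : ∀ i j, K (e i) (e j) ≠ 0 → r i + r j = 0)
    {f g : ℂ[T;T⁻¹] ⊗[ℂ] 𝔤} (hf : f ∈ gradedOrder e r) (hg : g ∈ gradedOrder e r) :
    K.baseChange ℂ[T;T⁻¹] f g ∈ valuationInftyGE 0 := by
  rw [baseChange_eq_sum e]
  refine sum_mem fun i _ ↦ sum_mem fun j _ ↦ ?_
  by_cases h : K (e i) (e j) = 0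
  · simp [h]
  · rw [← hK i j h]
    exact Submodule.smul_mem _ _ (mul_mem_valuationInftyGE (hf i) (hg j))

theorem residueForm_toLaurentAtZero [FiniteDimensional ℂ 𝔤] {f g : ℂ[T;T⁻¹] ⊗[ℂ] 𝔤}
    (h : (killingForm ℂ 𝔤).baseChange ℂ[T;T⁻¹] f g ∈ valuationInftyGE 0) :
    residueForm 𝔤 aSeries (toLaurentAtZero 𝔤 f) (toLaurentAtZero 𝔤 g) =
      epsForm 𝔤 (evalEps 𝔤 f) (evalEps 𝔤 g) := by
  rw [residueForm_apply, epsForm_apply, toLaurentAtZero, evalEps, baseChange_map, baseChange_map,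
    coeff_aSeries_mul]
  exact fun m hm ↦ h m (by simpa using hm)

theorem toLaurentAtZero_injective [FiniteDimensional ℂ 𝔤] :
    Function.Injective (toLaurentAtZero 𝔤) := by
  rw [injective_iff_map_eq_zero]
  intro f hf
  let e := finBasis ℂ 𝔤
  refine coords_ext e fun i ↦ ?_
  ext m
  have := congr_arg (fun y ↦ (coords e (LaurentSeries ℂ) y i).coeff m) hf
  simpa [toLaurentAtZero, coeff_substUnit_laurentVar] using this

theorem substUnit_surjOn_valuationInftyGE (d : ℤ) (x : DualNumber ℂ) :
    ∃ f ∈ valuationInftyGE d, substUnit onePlusEps⁻¹ f = x := by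
  -- Under `u = 1 - ε`, `u⁻ᵈ` becomes `1 + d ε` and `u⁻¹ - 1` becomes `ε`; the term `- d * x.fst`
  -- offsets the `d ε`.
  refine ⟨.single (-d) (x.fst) + .single (-d) (x.snd - d * x.fst) * (.single (-1) 1 - 1),
    add_mem (single_mem_valuationInftyGE (by simp) _) ?_, ?_⟩
  · rw [← add_zero (d : ℝ)]
    refine mul_mem_valuationInftyGE (single_mem_valuationInftyGE (by simp) _) (sub_mem ?_ ?_)
    · exact single_mem_valuationInftyGE (by simp) _
    · exact single_mem_valuationInftyGE (m := 0) (by simp) 1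
  · rw [map_add, map_mul, map_sub, map_one, substUnit_single, substUnit_single, substUnit_single]
    simp only [onePlusEps_inv_zpow]
    ext <;> simp
    ring

theorem substUnit_onePlusEps_inv_sq_mul (f : ℂ[T;T⁻¹]) :
    substUnit onePlusEps⁻¹ ((.single (-1) 1 - 1) ^ 2 * f) = 0 := by
  have : substUnit onePlusEps⁻¹ (.single (-1) 1 - 1 : ℂ[T;T⁻¹]) = DualNumber.eps := by
    rw [map_sub, map_one, substUnit_single, onePlusEps_inv_zpow]
    simp
  rw [map_mul, map_pow, this, pow_two, DualNumber.eps_mul_eps, zero_mul]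

end GradedOrder

/-! ### Dual vectors for a graded form -/

theorem baseChange_tmul_of_dual {ι 𝔤 A : Type*} [Fintype ι] [DecidableEq ι] [LieRing 𝔤]
    [LieAlgebra ℂ 𝔤] (e : Basis ι ℂ 𝔤) [CommRing A] [Algebra ℂ A] (K : LinearMap.BilinForm ℂ 𝔤)
    {x : 𝔤} {i : ι} (hx : ∀ j, K x (e j) = if j = i then 1 else 0) (a : A) (y : A ⊗[ℂ] 𝔤) :
    K.baseChange A (a ⊗ₜ x) y = a * coords e A y i := by
  conv_lhs => rw [← sum_coords_tmul e y]
  simp [map_sum, LinearMap.BilinForm.baseChange_tmul, hx]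

/-- The dual basis vector is truncated to its component of degree `-d i`. The pairings with basis
vectors of degree `d i` see only that component, and those with the others vanish by degree, as they
should. -/
theorem exists_dual_vector {ι V : Type*} [Fintype ι] [DecidableEq ι] [AddCommGroup V] [Module ℂ V]
    {e : Basis ι ℂ V} {d : ι → ℤ} {K : LinearMap.BilinForm ℂ V} (hnd : K.Nondegenerate)
    (hK : ∀ i j, K (e i) (e j) ≠ 0 → d i + d j = 0) (i : ι) :
    ∃ x, (∀ j, e.repr x j ≠ 0 → d j = -d i) ∧ ∀ j, K x (e j) = if j = i then 1 else 0 := by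
  let y := K.dualBasis hnd e i
  have hy (l : ι) : ∑ j, e.repr y j * K (e j) (e l) = if l = i then 1 else 0 := by
    rw [← LinearMap.BilinForm.apply_dualBasis_left hnd e i l]
    conv_rhs => rw [← e.sum_repr (K.dualBasis hnd e i)]
    simp only [map_sum, map_smul, LinearMap.sum_apply, LinearMap.smul_apply, smul_eq_mul, y]
  refine ⟨∑ j, (if d j = -d i then e.repr y j else 0) • e j, fun j hj ↦ ?_, fun l ↦ ?_⟩
  · rw [Basis.repr_sum_self] at hj
    by_contra h
    simp [h] at hj
  · simp only [map_sum, map_smul, LinearMap.sum_apply, LinearMap.smul_apply, smul_eq_mul]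
    by_cases hl : d l = d i
    · rw [← hy l]
      refine Finset.sum_congr rfl fun j _ ↦ ?_
      by_cases h : K (e j) (e l) = 0
      · simp [h]
      · rw [if_pos]
        linarith [hK j l h]
    · rw [if_neg (by rintro rfl; exact hl rfl)]
      refine Finset.sum_eq_zero fun j _ ↦ ?_
      by_cases h : K (e j) (e l) = 0
      · simp [h]
      · rw [if_neg, zero_mul]
        intro h'
        exact hl (by linarith [hK j l h])

/-! ### The subspace `𝔤[[u]]` in coordinates -/

section TaylorPart

variable {ι 𝔤 : Type*} [Fintype ι] [LieRing 𝔤] [LieAlgebra ℂ 𝔤] (e : Basis ι ℂ 𝔤)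

theorem ofPowerSeries_mk_coeff {y : LaurentSeries ℂ} (hy : ∀ m < 0, y.coeff m = 0) :
    HahnSeries.ofPowerSeries ℤ ℂ (PowerSeries.mk fun n ↦ y.coeff n) = y := by
  ext m
  rcases lt_or_ge m 0 with hm | hm
  · rw [ofPowerSeries_coeff_of_neg _ hm, hy m hm]
  · lift m to ℕ using hm
    rw [HahnSeries.ofPowerSeries_apply_coeff, PowerSeries.coeff_mk]

theorem mem_taylorPart_iff {f : LaurentSeries ℂ ⊗[ℂ] 𝔤} :
    f ∈ taylorPart 𝔤 ↔ ∀ i, ∀ m < 0, (coords e (LaurentSeries ℂ) f i).coeff m = 0 := by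
  have h (g : PowerSeries ℂ ⊗[ℂ] 𝔤) (i : ι) : coords e (LaurentSeries ℂ) (LinearMap.rTensor 𝔤
      (HahnSeries.ofPowerSeriesAlg (A := ℂ) (R := ℂ) (Γ := ℤ)).toLinearMap g) i =
      HahnSeries.ofPowerSeries ℤ ℂ (coords e (PowerSeries ℂ) g i) :=
    coords_map e (HahnSeries.ofPowerSeriesAlg (A := ℂ) (R := ℂ) (Γ := ℤ)) g i
  constructor
  · rintro ⟨g, rfl⟩ i m hm
    rw [h, ofPowerSeries_coeff_of_neg _ hm]
  · intro hf
    obtain ⟨g, hg⟩ := exists_coords_eq e fun i ↦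
      PowerSeries.mk fun n ↦ (coords e (LaurentSeries ℂ) f i).coeff n
    refine ⟨g, coords_ext e fun i ↦ ?_⟩
    rw [h, hg, ofPowerSeries_mk_coeff (hf i)]

end TaylorPart

/-! ### The order against the kernel of evaluation and against `𝔤[[u]]` -/

section Transversality

variable {ι 𝔤 : Type*} [Fintype ι] [LieRing 𝔤] [LieAlgebra ℂ 𝔤] {e : Basis ι ℂ 𝔤} {d : ι → ℤ}

theorem exists_mem_gradedOrder_evalEps_eq (z : DualNumber ℂ ⊗[ℂ] 𝔤) :
    ∃ f ∈ gradedOrder e (fun i ↦ d i), evalEps 𝔤 f = z := by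
  choose q hq hqz using fun i ↦ substUnit_surjOn_valuationInftyGE (d i) (coords e _ z i)
  obtain ⟨f, hf⟩ := exists_coords_eq e q
  refine ⟨f, fun i ↦ (hf i).symm ▸ hq i, coords_ext e fun i ↦ ?_⟩
  rw [evalEps, coords_map, hf, hqz]

/-- The double zero of `(u⁻¹ - 1)² = u⁻² (1 - u)²` at `u = 1` cancels the pole of `a(u)`, so
multiples of this square pair with a series by reading off single coefficients. -/
theorem aSeries_mul_substUnit_sq :
    aSeries * substUnit laurentVar ((.single (-1) 1 - 1) ^ 2) = HahnSeries.single (-2) 1 := by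
  have h : substUnit laurentVar (.single (-1) 1 - 1 : ℂ[T;T⁻¹]) =
      HahnSeries.single (-1) 1 * (1 - (laurentVar : LaurentSeries ℂ)) := by
    rw [map_sub, map_one, substUnit_single, laurentVar_zpow]
    simp [laurentVar, mul_sub]
  rw [map_pow, h, mul_pow, mul_left_comm, aSeries_mul_one_sub_sq, mul_one, HahnSeries.single_pow]
  simp

theorem exists_mem_gradedOrder_of_orthogonal [FiniteDimensional ℂ 𝔤]
    (hnd : (killingForm ℂ 𝔤).Nondegenerate)
    (hK : ∀ i j, killingForm ℂ 𝔤 (e i) (e j) ≠ 0 → d i + d j = 0) (y : LaurentSeries ℂ ⊗[ℂ] 𝔤)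
    (hy : ∀ f ∈ gradedOrder e (fun i ↦ d i), evalEps 𝔤 f = 0 →
      residueForm 𝔤 aSeries (toLaurentAtZero 𝔤 f) y = 0) :
    ∃ f ∈ gradedOrder e (fun i ↦ d i), toLaurentAtZero 𝔤 f = y := by
  classical
  have hcoeff (i : ι) (m : ℤ) (hm : -d i < m) : (coords e _ y i).coeff m = 0 := by
    obtain ⟨x, hxd, hxe⟩ := exists_dual_vector hnd hK i
    -- Here `a(u) p = u^(-1 - m)`, so pairing with `p ⊗ x` extracts the coefficient of `uᵐ` in the
    -- `i`-th coordinate of `y`. The valuation `m - 1 ≥ -d i` places `p ⊗ x` in the order, and the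
    -- square factor in the kernel of evaluation.
    let p : ℂ[T;T⁻¹] := (.single (-1) 1 - 1) ^ 2 * .single (1 - m) 1
    have hp : p ∈ valuationInftyGE (-d i : ℤ) := by
      have h1 : (.single (-1) 1 - 1 : ℂ[T;T⁻¹]) ∈ valuationInftyGE 0 :=
        sub_mem (single_mem_valuationInftyGE (by simp) _)
          (single_mem_valuationInftyGE (m := 0) (by simp) 1)
      have h2 : (.single (1 - m) 1 : ℂ[T;T⁻¹]) ∈ valuationInftyGE (-d i : ℤ) := by
        refine single_mem_valuationInftyGE ?_ 1
        exact_mod_cast (by linarith : -d i ≤ -(1 - m))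
      simpa [p, pow_two] using
        mul_mem_valuationInftyGE (mul_mem_valuationInftyGE h1 h1) h2
    have h := hy (p ⊗ₜ x) (fun j ↦ ?_) ?_
    · rw [show toLaurentAtZero 𝔤 (p ⊗ₜ x) = substUnit laurentVar p ⊗ₜ x from rfl,
        residueForm_apply, baseChange_tmul_of_dual e _ hxe, ← mul_assoc, map_mul, ← mul_assoc,
        aSeries_mul_substUnit_sq, substUnit_single, laurentVar_zpow, one_smul,
        HahnSeries.single_mul_single, HahnSeries.coeff_single_mul, one_mul, one_mul] at h
      rwa [show -1 - (-2 + (1 - m)) = m by ring] at h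
    · rw [coords_tmul]
      by_cases hj : e.repr x j = 0
      · simp [hj]
      · rw [← hxd j hj] at hp
        exact Submodule.smul_mem _ _ hp
    · change substUnit onePlusEps⁻¹ p ⊗ₜ x = 0
      rw [substUnit_onePlusEps_inv_sq_mul, TensorProduct.zero_tmul]
  choose q hq using fun i ↦ exists_substUnit_eq_of_coeff_eq_zero (coords e _ y i) (-d i) (hcoeff i)
  obtain ⟨f, hf⟩ := exists_coords_eq e q
  refine ⟨f, fun i m hm ↦ ?_, coords_ext e fun i ↦ ?_⟩
  · rw [hf, ← coeff_substUnit_laurentVar, hq]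
    refine hcoeff i m ?_
    have hm' : -(m : ℝ) < d i := hm
    have : -m < d i := by exact_mod_cast hm'
    linarith
  · rw [toLaurentAtZero, coords_map, hf, hq]

/-- Principal parts lie in `u⁻¹ ℂ[u⁻¹]`, so they have valuation at least `1` at infinity and meet
every bound `d i ≤ 1`. -/
theorem exists_gradedOrder_add_taylorPart (hd : ∀ i, d i ≤ 1) (y : LaurentSeries ℂ ⊗[ℂ] 𝔤) :
    ∃ f ∈ gradedOrder e (fun i ↦ d i), ∃ p ∈ taylorPart 𝔤, toLaurentAtZero 𝔤 f + p = y := by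
  have h (y : LaurentSeries ℂ) : ∃ q ∈ valuationInftyGE 1,
      ∀ m < 0, (substUnit laurentVar q).coeff m = y.coeff m := by
    let z := y - HahnSeries.ofPowerSeries ℤ ℂ (PowerSeries.mk fun n ↦ y.coeff n)
    have hz (m : ℤ) (hm : -1 < m) : z.coeff m = 0 := by
      lift m to ℕ using by omega
      rw [HahnSeries.coeff_sub, HahnSeries.ofPowerSeries_apply_coeff, PowerSeries.coeff_mk,
        sub_self]
    obtain ⟨q, hq⟩ := exists_substUnit_eq_of_coeff_eq_zero z (-1) hz
    refine ⟨q, fun m hm ↦ ?_, fun m hm ↦ ?_⟩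
    · rw [← coeff_substUnit_laurentVar, hq, hz]
      have : -m < 1 := by exact_mod_cast hm
      linarith
    · rw [hq, HahnSeries.coeff_sub, ofPowerSeries_coeff_of_neg _ hm, sub_zero]
  choose q hq hqy using fun i ↦ h (coords e _ y i)
  obtain ⟨f, hf⟩ := exists_coords_eq e q
  refine ⟨f, fun i ↦ ?_, y - toLaurentAtZero 𝔤 f, ?_, add_sub_cancel _ _⟩
  · rw [hf]
    exact valuationInftyGE_anti (d := 1) (show (d i : ℝ) ≤ 1 by exact_mod_cast hd i) (hq i)
  · rw [mem_taylorPart_iff e]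
    intro i m hm
    rw [map_sub, Pi.sub_apply, toLaurentAtZero, coords_map, hf, HahnSeries.coeff_sub, hqy i m hm,
      sub_self]

/-- Membership in `𝔤[[u]]` leaves powers `uᵐ` with `m ≥ 0`, and the order requires `m ≤ -d i ≤ 1`.
-/
theorem coords_eq_of_mem_taylorPart (hd : ∀ i, -1 ≤ d i) {f : ℂ[T;T⁻¹] ⊗[ℂ] 𝔤}
    (hf : f ∈ gradedOrder e (fun i ↦ d i)) (hfT : toLaurentAtZero 𝔤 f ∈ taylorPart 𝔤) (i : ι) :
    ∃ a b : ℂ, coords e _ f i = .single 0 a + .single 1 b ∧ (0 < d i → a = 0) ∧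
      (0 ≤ d i → b = 0) := by
  have h1 (m : ℤ) (hm : m < 0) : (coords e _ f i).coeff m = 0 := by
    have := (mem_taylorPart_iff e).mp hfT i m hm
    rwa [toLaurentAtZero, coords_map, coeff_substUnit_laurentVar] at this
  have h2 (m : ℤ) (hm : -m < d i) : (coords e _ f i).coeff m = 0 :=
    hf i m (show -(m : ℝ) < d i by exact_mod_cast hm)
  refine ⟨(coords e _ f i).coeff 0, (coords e _ f i).coeff 1, ?_, fun h ↦ h2 0 (by simpa),
    fun h ↦ h2 1 (by linarith)⟩
  ext m
  rw [AddMonoidAlgebra.coeff_add, AddMonoidAlgebra.coeff_single, AddMonoidAlgebra.coeff_single,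
    Finsupp.add_apply, Finsupp.single_apply, Finsupp.single_apply]
  by_cases hm0 : m < 0
  · rw [h1 m hm0, if_neg (by omega), if_neg (by omega), add_zero]
  by_cases hm1 : 1 < m
  · rw [h2 m (by linarith [hd i]), if_neg (by omega), if_neg (by omega), add_zero]
  obtain rfl | rfl : m = 0 ∨ m = 1 := by omega
  · simp
  · simp

theorem substUnit_single_zero_add_single_one (a b : ℂ) :
    substUnit onePlusEps⁻¹ (.single 0 a + .single 1 b) =
      TrivSqZeroExt.inl (a + b) - TrivSqZeroExt.inr b := by
  rw [map_add, substUnit_single, substUnit_single, onePlusEps_inv_zpow, onePlusEps_inv_zpow]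
  ext <;> simp

variable (e d) in
/-- The elements of `𝔤[ε]` without components of degree `1`, and whose components of degree `0`
are constant. -/
def gradedEps : Submodule ℂ (DualNumber ℂ ⊗[ℂ] 𝔤) where
  carrier := {f | ∀ i, (0 < d i → (coords e (DualNumber ℂ) f i).fst = 0) ∧
    (0 ≤ d i → (coords e (DualNumber ℂ) f i).snd = 0)}
  zero_mem' i := by simp
  add_mem' hf hg i := by
    refine ⟨fun h ↦ ?_, fun h ↦ ?_⟩
    · simp [(hf i).1 h, (hg i).1 h]
    · simp [(hf i).2 h, (hg i).2 h]
  smul_mem' c f hf i := by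
    rw [coords_smul]
    refine ⟨fun h ↦ ?_, fun h ↦ ?_⟩
    · simp [(hf i).1 h]
    · simp [(hf i).2 h]

theorem evalEps_mem_gradedEps (hd : ∀ i, -1 ≤ d i) {f : ℂ[T;T⁻¹] ⊗[ℂ] 𝔤}
    (hf : f ∈ gradedOrder e (fun i ↦ d i)) (hfT : toLaurentAtZero 𝔤 f ∈ taylorPart 𝔤) :
    evalEps 𝔤 f ∈ gradedEps e d := by
  intro i
  obtain ⟨a, b, hab, ha, hb⟩ := coords_eq_of_mem_taylorPart hd hf hfT i
  rw [evalEps, coords_map, hab, substUnit_single_zero_add_single_one]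
  refine ⟨fun h ↦ ?_, fun h ↦ ?_⟩
  · simp [ha h, hb h.le]
  · simp [hb h]

theorem eq_zero_of_evalEps_eq_zero (hd : ∀ i, -1 ≤ d i) {f : ℂ[T;T⁻¹] ⊗[ℂ] 𝔤}
    (hf : f ∈ gradedOrder e (fun i ↦ d i)) (hfT : toLaurentAtZero 𝔤 f ∈ taylorPart 𝔤)
    (h0 : evalEps 𝔤 f = 0) : f = 0 := by
  refine coords_ext e fun i ↦ ?_
  obtain ⟨a, b, hab, -, -⟩ := coords_eq_of_mem_taylorPart hd hf hfT i
  have h : substUnit onePlusEps⁻¹ (coords e _ f i) = 0 := by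
    rw [← coords_map e, ← evalEps, h0]
    simp
  rw [hab, substUnit_single_zero_add_single_one] at h
  have hb : b = 0 := by simpa using congr_arg TrivSqZeroExt.snd h
  have ha : a = 0 := by simpa [hb] using congr_arg TrivSqZeroExt.fst h
  rw [hab, ha, hb]
  simp

theorem exists_evalEps_eq_of_mem_gradedEps {x : DualNumber ℂ ⊗[ℂ] 𝔤}
    (hx : x ∈ gradedEps e d) : ∃ f ∈ gradedOrder e (fun i ↦ d i),
      toLaurentAtZero 𝔤 f ∈ taylorPart 𝔤 ∧ evalEps 𝔤 f = x := by
  -- These coefficients invert the evaluation `a + b u ↦ (a + b) - b ε`.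
  obtain ⟨f, hf⟩ := exists_coords_eq e fun i ↦
    (.single 0 ((coords e _ x i).fst + (coords e _ x i).snd) +
      .single 1 (-(coords e _ x i).snd) : ℂ[T;T⁻¹])
  refine ⟨f, fun i m hm ↦ ?_, (mem_taylorPart_iff e).mpr fun i m hm ↦ ?_, coords_ext e fun i ↦ ?_⟩
  · have hm : -(m : ℝ) < d i := hm
    have hm : -m < d i := by exact_mod_cast hm
    rw [hf, AddMonoidAlgebra.coeff_add, AddMonoidAlgebra.coeff_single,
      AddMonoidAlgebra.coeff_single, Finsupp.add_apply, Finsupp.single_apply, Finsupp.single_apply]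
    have h1 := (hx i).1
    have h2 := (hx i).2
    split_ifs with h3 h4 h4
    · omega
    · rw [h1 (by omega), h2 (by omega)]
      simp
    · rw [h2 (by omega)]
      simp
    · simp
  · rw [toLaurentAtZero, coords_map, coeff_substUnit_laurentVar, hf, AddMonoidAlgebra.coeff_add,
      AddMonoidAlgebra.coeff_single, AddMonoidAlgebra.coeff_single, Finsupp.add_apply,
      Finsupp.single_apply, Finsupp.single_apply, if_neg (by omega), if_neg (by omega), add_zero]
  · rw [evalEps, coords_map, hf, substUnit_single_zero_add_single_one]
    ext <;> simp

theorem bijOn_evalSubalgebra [FiniteDimensional ℂ 𝔤]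
    (hnd : (killingForm ℂ 𝔤).Nondegenerate)
    (hK : ∀ i j, killingForm ℂ 𝔤 (e i) (e j) ≠ 0 → d i + d j = 0)
    (hlie : ∀ i j l, e.repr ⁅e i, e j⁆ l ≠ 0 → d l = d i + d j)
    (hd : ∀ i, -1 ≤ d i) (hd' : ∀ i, d i ≤ 1) :
    Set.BijOn evalSubalgebra
      {W : LieSubalgebra ℂ (LaurentSeries ℂ ⊗[ℂ] 𝔤) | IsLagrangian (residueForm 𝔤 aSeries) W ∧
        IsCompl W.toSubmodule (taylorPart 𝔤) ∧
        W.toSubmodule ≤ (gradedOrder e fun i ↦ d i).map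
          (toLaurentAtZero 𝔤 : ℂ[T;T⁻¹] ⊗[ℂ] 𝔤 →ₗ[ℂ] _)}
      {V | IsLagrangian (epsForm 𝔤) V ∧ IsCompl V.toSubmodule (gradedEps e d)} :=
  bijOn_lagrangian (toLaurentAtZero 𝔤) (evalEps 𝔤) toLaurentAtZero_injective
    (gradedOrder e fun i ↦ d i)
    (fun _ hf _ hg ↦ lie_mem_gradedOrder (fun i j l h ↦ by exact_mod_cast hlie i j l h) hf hg)
    _ _ _ _
    (fun _ hf _ hg ↦ residueForm_toLaurentAtZero
      (baseChange_mem_valuationInftyGE (fun i j h ↦ by exact_mod_cast hK i j h) hf hg))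
    exists_mem_gradedOrder_evalEps_eq
    (exists_mem_gradedOrder_of_orthogonal hnd hK)
    (exists_gradedOrder_add_taylorPart hd')
    (fun _ ↦ evalEps_mem_gradedEps hd)
    (fun _ ↦ eq_zero_of_evalEps_eq_zero hd)
    (fun _ ↦ exists_evalEps_eq_of_mem_gradedEps)

/-- As `P` is the part of degree at most `0` and `K` is nondegenerate and pairs opposite degrees,
the complement of `P` is the part of negative degree. -/
theorem parabolic_eps_eq_gradedEps [DecidableEq ι]
    (hnd : (killingForm ℂ 𝔤).Nondegenerate)
    (hK : ∀ i j, killingForm ℂ 𝔤 (e i) (e j) ≠ 0 → d i + d j = 0) {P : Submodule ℂ 𝔤}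
    (hP : ∀ v, v ∈ P ↔ ∀ i, 0 < d i → e.repr v i = 0) :
    P.map (TensorProduct.mk ℂ (DualNumber ℂ) 𝔤 1) ⊔
      ((killingForm ℂ 𝔤).orthogonal P).map (TensorProduct.mk ℂ (DualNumber ℂ) 𝔤 DualNumber.eps) =
    gradedEps e d := by
  have hP' (v : 𝔤) : v ∈ (killingForm ℂ 𝔤).orthogonal P ↔ ∀ i, 0 ≤ d i → e.repr v i = 0 := by
    constructor
    · intro hv i hi
      obtain ⟨x, hxd, hxe⟩ := exists_dual_vector hnd hK i
      have hx : x ∈ P := (hP x).mpr fun j hj ↦ by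
        by_contra h
        linarith [hxd j h]
      have h : killingForm ℂ 𝔤 x v = 0 := hv x hx
      rw [← e.sum_repr v, map_sum] at h
      simp_rw [map_smul, hxe] at h
      simpa using h
    · intro hv w hw
      change killingForm ℂ 𝔤 w v = 0
      rw [← e.sum_repr v, ← e.sum_repr w]
      simp only [map_sum, map_smul, LinearMap.sum_apply, LinearMap.smul_apply, smul_eq_mul]
      refine Finset.sum_eq_zero fun i _ ↦ ?_
      rcases lt_or_ge (d i) 0 with hi | hi
      · refine mul_eq_zero_of_right _ (Finset.sum_eq_zero fun j _ ↦ ?_)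
        rcases lt_or_ge 0 (d j) with hj | hj
        · simp [(hP w).mp hw j hj]
        · have : killingForm ℂ 𝔤 (e j) (e i) = 0 := by
            by_contra h
            linarith [hK j i h]
          simp [this]
      · simp [hv i hi]
  apply le_antisymm
  · refine sup_le ?_ ?_ <;> rintro - ⟨v, hv, rfl⟩ i
    · have := (hP v).mp hv i
      refine ⟨fun h ↦ ?_, fun h ↦ ?_⟩
      · simp [this h]
      · simp
    · have := (hP' v).mp hv i
      refine ⟨fun h ↦ ?_, fun h ↦ ?_⟩
      · simp
      · simp [this h]
  · intro f hf
    rw [← sum_coords_tmul e f]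
    refine sum_mem fun i _ ↦ ?_
    obtain ⟨h1, h2⟩ := hf i
    set x := coords e _ f i
    have hx : x ⊗ₜ[ℂ] e i = (1 : DualNumber ℂ) ⊗ₜ[ℂ] (x.fst • e i) +
        (DualNumber.eps : DualNumber ℂ) ⊗ₜ[ℂ] (x.snd • e i) := by
      rw [← TensorProduct.smul_tmul, ← TensorProduct.smul_tmul, ← TensorProduct.add_tmul]
      congr 1
      ext <;> simp
    rw [hx]
    refine Submodule.add_mem_sup ⟨_, (hP _).mpr fun j hj ↦ ?_, rfl⟩
      ⟨_, (hP' _).mpr fun j hj ↦ ?_, rfl⟩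
    · rcases eq_or_ne i j with rfl | hij
      · simp [h1 hj]
      · simp [hij]
    · rcases eq_or_ne i j with rfl | hij
      · simp [h2 hj]
      · simp [hij]

end Transversality

variable {𝔤 : Type*} [LieRing 𝔤] [LieAlgebra ℂ 𝔤] [FiniteDimensional ℂ 𝔤]
  {H : LieSubalgebra ℂ 𝔤} [H.IsCartanSubalgebra]

/-! ### A basis of root vectors and its grading -/

section RootBasis

open Classical in
theorem isInternal_rootSpace : DirectSum.IsInternal
    fun χ : LieModule.Weight ℂ H 𝔤 ↦ (rootSpace H χ).toSubmodule := by
  refine DirectSum.isInternal_submodule_of_iSupIndep_of_iSup_eq_top ?_ ?_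
  · rw [LieSubmodule.iSupIndep_toSubmodule]
    exact LieModule.iSupIndep_genWeightSpace' ℂ H 𝔤
  · rw [← LieSubmodule.iSup_toSubmodule, LieModule.iSup_genWeightSpace_eq_top' ℂ H 𝔤,
      LieSubmodule.top_toSubmodule]

variable (H) in
/-- The index type of a basis of root vectors. -/
abbrev RootBasisIndex : Type _ :=
  Σ χ : LieModule.Weight ℂ H 𝔤, Fin (finrank ℂ (rootSpace H χ).toSubmodule)

open Classical in
variable (H) in
/-- A basis of `𝔤` adapted to the root space decomposition. -/
def rootBasis : Basis (RootBasisIndex H) ℂ 𝔤 :=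
  isInternal_rootSpace.collectedBasis fun _ ↦ finBasis ℂ _

theorem rootBasis_mem (i : RootBasisIndex H) : rootBasis H i ∈ rootSpace H i.1 := by
  classical
  exact isInternal_rootSpace.collectedBasis_mem (fun χ ↦ finBasis ℂ _) i

theorem rootBasis_repr_eq_zero {χ : LieModule.Weight ℂ H 𝔤} {x : 𝔤} (hx : x ∈ rootSpace H χ)
    (i : RootBasisIndex H) (h : i.1 ≠ χ) : (rootBasis H).repr x i = 0 := by
  classical
  exact isInternal_rootSpace.collectedBasis_repr_of_mem_ne _ h.symm hx

theorem rootBasis_add_eq_zero {i j : RootBasisIndex H}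
    (h : killingForm ℂ 𝔤 (rootBasis H i) (rootBasis H j) ≠ 0) (v : H) : i.1 v + j.1 v = 0 := by
  by_contra h'
  refine h (killingForm_apply_eq_zero_of_mem_rootSpace_of_add_ne_zero ℂ 𝔤 H (rootBasis_mem i)
    (rootBasis_mem j) fun h0 ↦ h' ?_)
  exact congr_fun h0 v

theorem rootBasis_eq_add {i j l : RootBasisIndex H}
    (h : (rootBasis H).repr ⁅rootBasis H i, rootBasis H j⁆ l ≠ 0) (v : H) :
    l.1 v = i.1 v + j.1 v := by
  have hmem := lie_mem_genWeightSpace_of_mem_genWeightSpace (rootBasis_mem i) (rootBasis_mem j)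
  have hne : ⁅rootBasis H i, rootBasis H j⁆ ≠ 0 := by
    intro h0
    simp [h0] at h
  let χ : LieModule.Weight ℂ H 𝔤 := ⟨i.1 + j.1, fun hbot ↦ hne (by simpa [hbot] using hmem)⟩
  have hl : l.1 = χ := by
    by_contra h'
    exact h (rootBasis_repr_eq_zero (χ := χ) hmem l h')
  rw [hl]
  rfl

theorem rootSpace_toSubmodule_eq {χ : LieModule.Weight ℂ H 𝔤} (hχ : χ.IsZero) :
    (rootSpace H χ).toSubmodule = H.toSubmodule := by
  rw [hχ.eq, rootSpace_zero_eq]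
  rfl

theorem mem_root_iff {χ : LieModule.Weight ℂ H 𝔤} : χ ∈ H.root ↔ ¬ χ.IsZero := by
  simp [LieModule.Weight.IsNonZero]

theorem exists_isZero_or (χ : LieModule.Weight ℂ H 𝔤) :
    χ.IsZero ∨ ∃ β : H.root, β.1 = χ := by
  by_cases h : χ.IsZero
  · exact .inl h
  · exact .inr ⟨⟨χ, mem_root_iff.mpr h⟩, rfl⟩

theorem rootBasis_repr_eq_zero_of_mem {x : 𝔤} (hx : x ∈ H) (i : RootBasisIndex H)
    (h : ¬ i.1.IsZero) : (rootBasis H).repr x i = 0 := by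
  have hx0 : x ∈ rootSpace H (0 : H → ℂ) := by
    rw [rootSpace_zero_eq]
    exact hx
  rcases eq_or_ne x 0 with rfl | hne
  · simp
  let χ : LieModule.Weight ℂ H 𝔤 := ⟨0, fun hbot ↦ hne (by simpa [hbot] using hx0)⟩
  refine rootBasis_repr_eq_zero (χ := χ) hx0 i ?_
  rintro h'
  exact h (by rw [h']; rfl)

end RootBasis

variable [LieAlgebra.IsKilling ℂ 𝔤]

/-! ### The order `𝕆_h` in root coordinates -/

section Order

theorem mem_maximalOrder_iff {h : H} {f : LaurentSeries ℂ ⊗[ℂ] 𝔤} :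
    f ∈ maximalOrder H h ↔
      ∀ i, coords (rootBasis H) (LaurentSeries ℂ) f i ∈ valuationGE (i.1 h).re := by
  constructor
  · let N : Submodule ℂ (LaurentSeries ℂ ⊗[ℂ] 𝔤) :=
      { carrier := {f | ∀ i, coords (rootBasis H) (LaurentSeries ℂ) f i ∈ valuationGE (i.1 h).re}
        zero_mem' := fun i ↦ by simp
        add_mem' := fun hf hg i ↦ by simpa using add_mem (hf i) (hg i)
        smul_mem' := fun c f hf i ↦ by
          rw [coords_smul]
          exact Submodule.smul_mem _ _ (hf i) }
    suffices maximalOrder H h ≤ N from fun hf ↦ this hf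
    refine sup_le ?_ (iSup_le fun β ↦ ?_)
    · refine Submodule.map₂_le.mpr fun a ha x hx i ↦ ?_
      change coords (rootBasis H) (LaurentSeries ℂ) (a ⊗ₜ x) i ∈ _
      by_cases hi : i.1.IsZero
      · rw [hi.eq, coords_tmul]
        exact Submodule.smul_mem _ _ (by simpa using ha)
      · rw [coords_tmul_eq_zero _ _ (rootBasis_repr_eq_zero_of_mem hx i hi)]
        exact zero_mem _
    · refine Submodule.map₂_le.mpr fun a ha x hx i ↦ ?_
      change coords (rootBasis H) (LaurentSeries ℂ) (a ⊗ₜ x) i ∈ _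
      by_cases hi : i.1 = β.1
      · rw [hi, coords_tmul]
        exact Submodule.smul_mem _ _ ha
      · rw [coords_tmul_eq_zero _ _ (rootBasis_repr_eq_zero hx i hi)]
        exact zero_mem _
  · intro hf
    rw [← sum_coords_tmul (rootBasis H) f]
    refine sum_mem fun i _ ↦ ?_
    rcases exists_isZero_or i.1 with hi | ⟨β, hi⟩
    · refine Submodule.mem_sup_left (Submodule.apply_mem_map₂ _ ?_ ?_)
      · have := hf i
        rwa [hi.eq] at this
      · rw [← rootSpace_toSubmodule_eq hi]
        exact rootBasis_mem i
    · refine Submodule.mem_sup_right (Submodule.mem_iSup_of_mem β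
        (Submodule.apply_mem_map₂ _ ?_ ?_))
      · have := hf i
        rwa [← hi] at this
      · have := rootBasis_mem i
        rwa [← hi] at this

theorem comap_maximalOrder (h : H) :
    (maximalOrder H h).comap (toLaurentAtInfty 𝔤 : ℂ[T;T⁻¹] ⊗[ℂ] 𝔤 →ₗ[ℂ] _) =
      gradedOrder (rootBasis H) fun i ↦ (i.1 h).re := by
  ext f
  rw [Submodule.mem_comap, mem_maximalOrder_iff, mem_gradedOrder]
  refine forall_congr' fun i ↦ ?_
  change coords (rootBasis H) (LaurentSeries ℂ) (toLaurentAtInfty 𝔤 f) i ∈ _ ↔ _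
  rw [toLaurentAtInfty, coords_map, substUnit_laurentVar_inv_mem_valuationGE_iff]

end Order

/-! ### Degrees of the roots, and the two cases of the theorem -/

section Roots

variable (b : (rootSystem H).Base)

theorem root_apply (β : H.root) (v : H) : (rootSystem H).root β v = β.1 v := by
  rw [rootSystem_root_apply]
  rfl

theorem exists_neg_root (β : H.root) : ∃ γ : H.root, (rootSystem H).root γ =
    -(rootSystem H).root β :=
  ⟨(rootSystem H).reflectionPerm β β, by
    rw [RootPairing.root_reflectionPerm, RootPairing.reflection_apply_self]⟩

theorem toWeightBasis_repr_eq (x : Dual ℂ H) (α : b.support) :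
    b.toWeightBasis.repr x α = x (vertex b α 1) := by
  simp [vertex]

theorem sum_root_vertex (α : b.support) (k : ℕ) (c : b.support → ℕ) :
    (∑ j : b.support, c j • (rootSystem H).root j) (vertex b α k) = c α * (k : ℂ)⁻¹ := by
  classical
  simp_rw [LinearMap.sum_apply, LinearMap.smul_apply, root_vertex]
  simp

theorem exists_sum_eq_or (β : H.root) : ∃ c : b.support → ℕ,
    (b.IsPos β ∧ (rootSystem H).root β = ∑ j : b.support, c j • (rootSystem H).root j) ∨
    (¬ b.IsPos β ∧ (rootSystem H).root β = -∑ j : b.support, c j • (rootSystem H).root j) := by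
  obtain ⟨f, -, hf⟩ := b.exists_root_eq_sum_nat_or_neg β
  refine ⟨fun j ↦ f j, ?_⟩
  rw [Finset.sum_coe_sort b.support fun j ↦ f j • (rootSystem H).root j]
  rcases hf with hf | hf
  · refine .inl ⟨?_, hf⟩
    rw [RootPairing.Base.isPos_iff', RootPairing.Base.height_eq_sum (f := fun j ↦ (f j : ℤ))
      (by simpa using hf)]
    positivity
  · refine .inr ⟨?_, hf⟩
    rw [RootPairing.Base.isPos_iff, RootPairing.Base.height_eq_sum (f := fun j ↦ -(f j : ℤ))
      (by simpa using hf), Finset.sum_neg_distrib, not_lt, neg_nonpos]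
    positivity

variable {b} {θ : H.root} {k : b.support → ℕ} {α : b.support}

/-- The highest root takes the value `1` at the vertex, and `θ - β` takes a natural value there, so
`β` takes an integral value at most `1`. The lower bound is the same statement for `-β`. -/
theorem exists_int_vertex (hθ : IsHighestRoot b θ)
    (hk : (rootSystem H).root θ = ∑ j : b.support, k j • (rootSystem H).root j)
    (hα : k α = 1) (χ : LieModule.Weight ℂ H 𝔤) :
    ∃ n : ℤ, χ (vertex b α 1) = n ∧ -1 ≤ n ∧ n ≤ 1 := by
  rcases exists_isZero_or χ with h | ⟨β, rfl⟩
  · exact ⟨0, by simp [h.eq]⟩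
  have key (β : H.root) : ∃ c : ℕ, (rootSystem H).root β (vertex b α 1) = 1 - c := by
    obtain ⟨c, hc⟩ := hθ β
    refine ⟨c α, ?_⟩
    have h1 := LinearMap.congr_fun hc (vertex b α 1)
    rw [LinearMap.sub_apply, hk, sum_root_vertex, sum_root_vertex, hα] at h1
    simp only [Nat.cast_one, inv_one, mul_one] at h1
    linear_combination -h1
  obtain ⟨c, hc⟩ := key β
  obtain ⟨γ, hγ⟩ := exists_neg_root β
  obtain ⟨c', hc'⟩ := key γ
  rw [hγ, LinearMap.neg_apply, hc] at hc'
  have h2 : (c : ℤ) + c' = 2 := by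
    have : (c : ℂ) + c' = 2 := by linear_combination hc'
    exact_mod_cast this
  refine ⟨1 - c, ?_, by omega, by omega⟩
  rw [← root_apply, hc]
  push_cast
  rfl

/-- The degree of a root is its coefficient at `α`, so the root spaces missing from `P_α⁻` are
exactly those of positive degree. -/
theorem mem_parabolicNeg_iff {d : RootBasisIndex H → ℤ}
    (hd : ∀ i, i.1 (vertex b α 1) = d i) (v : 𝔤) :
    v ∈ parabolicNeg b α ↔ ∀ i, 0 < d i → (rootBasis H).repr v i = 0 := by
  have hd0 (i : RootBasisIndex H) (hi : i.1.IsZero) : d i = 0 := by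
    have := hd i
    rw [hi.eq, Pi.zero_apply] at this
    exact_mod_cast this.symm
  have hdpos (i : RootBasisIndex H) (β : H.root) (hi : β.1 = i.1) :
      (0 < d i → b.IsPos β) ∧ (d i < 0 → ¬ b.IsPos β) ∧
        (b.toWeightBasis.repr ((rootSystem H).root β) α = 0 ↔ d i = 0) := by
    have h1 : (rootSystem H).root β (vertex b α 1) = d i := by rw [root_apply, hi, hd]
    obtain ⟨c, ⟨hp, hc⟩ | ⟨hp, hc⟩⟩ := exists_sum_eq_or b β
    · rw [toWeightBasis_repr_eq, h1]
      rw [hc, sum_root_vertex] at h1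
      have h2 : (c α : ℤ) = d i := by
        simp only [Nat.cast_one, inv_one, mul_one] at h1
        exact_mod_cast h1
      exact ⟨fun _ ↦ hp, fun h ↦ by omega, by norm_cast⟩
    · rw [toWeightBasis_repr_eq, h1]
      rw [hc, LinearMap.neg_apply, sum_root_vertex] at h1
      have h2 : -(c α : ℤ) = d i := by
        simp only [Nat.cast_one, inv_one, mul_one] at h1
        exact_mod_cast h1
      exact ⟨fun h ↦ by omega, fun _ ↦ hp, by norm_cast⟩
  constructor
  · let N : Submodule ℂ 𝔤 :=
      { carrier := {v | ∀ i, 0 < d i → (rootBasis H).repr v i = 0}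
        zero_mem' := fun i _ ↦ by simp
        add_mem' := fun hf hg i hi ↦ by simp [hf i hi, hg i hi]
        smul_mem' := fun c f hf i hi ↦ by simp [hf i hi] }
    suffices parabolicNeg b α ≤ N from fun hv ↦ this hv
    refine sup_le (fun x hx i hi ↦ ?_) (iSup_le fun β x hx i hi ↦ ?_)
    · exact rootBasis_repr_eq_zero_of_mem hx i fun h ↦ by simp [hd0 i h] at hi
    · refine rootBasis_repr_eq_zero hx i fun h ↦ ?_
      obtain ⟨h1, -, h3⟩ := hdpos i β.1 h.symm
      rcases β.2 with h4 | h4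
      · exact h4 (h1 hi)
      · rw [h3] at h4
        omega
  · intro hv
    rw [← (rootBasis H).sum_repr v]
    refine sum_mem fun i _ ↦ ?_
    by_cases hi : 0 < d i
    · simp [hv i hi]
    refine Submodule.smul_mem _ _ ?_
    rcases exists_isZero_or i.1 with h0 | ⟨β, hβ⟩
    · refine Submodule.mem_sup_left ?_
      rw [← rootSpace_toSubmodule_eq h0]
      exact rootBasis_mem i
    · obtain ⟨-, h2, h3⟩ := hdpos i β hβ
      have hβ' : ¬ b.IsPos β ∨ b.toWeightBasis.repr ((rootSystem H).root β) α = 0 := by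
        rw [h3]
        rcases (not_lt.mp hi).lt_or_eq with h | h
        · exact .inl (h2 h)
        · exact .inr h
      refine Submodule.mem_sup_right (Submodule.mem_iSup_of_mem ⟨β, hβ'⟩ ?_)
      have := rootBasis_mem i
      rwa [← hβ] at this

theorem bijOn_lagrangiansInOrder (hθ : IsHighestRoot b θ)
    (hk : (rootSystem H).root θ = ∑ j : b.support, k j • (rootSystem H).root j)
    (hα : k α = 1) :
    Set.BijOn evalSubalgebra (lagrangiansInOrder b α 1) (lagrangiansEps b α) := by
  classical
  choose d hd hd1 hd2 using
    fun i : RootBasisIndex H ↦ exists_int_vertex hθ hk hα i.1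
  have hnd := killingForm_nondegenerate ℂ 𝔤
  have hK (i j) (h : killingForm ℂ 𝔤 (rootBasis H i) (rootBasis H j) ≠ 0) : d i + d j = 0 := by
    have := rootBasis_add_eq_zero h (vertex b α 1)
    rw [hd, hd] at this
    exact_mod_cast this
  have hlie (i j l) (h : (rootBasis H).repr ⁅rootBasis H i, rootBasis H j⁆ l ≠ 0) :
      d l = d i + d j := by
    have := rootBasis_eq_add h (vertex b α 1)
    rw [hd, hd, hd] at this
    exact_mod_cast this
  have h := bijOn_evalSubalgebra hnd hK hlie hd1 hd2
  have hO : (gradedOrder (rootBasis H) fun i ↦ (d i : ℝ)).map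
      (toLaurentAtZero 𝔤 : ℂ[T;T⁻¹] ⊗[ℂ] 𝔤 →ₗ[ℂ] _) = orderLaurent (vertex b α 1) := by
    rw [orderLaurent, comap_maximalOrder]
    simp_rw [hd, Complex.intCast_re]
  have hP : gradedEps (rootBasis H) d = parabolicEps b α :=
    (parabolic_eps_eq_gradedEps hnd hK (mem_parabolicNeg_iff hd)).symm
  rw [hO, hP] at h
  exact h

theorem lagrangiansInOrder_eq_empty (α : b.support) {k : ℕ} (hk : 1 < k) :
    lagrangiansInOrder b α k = ∅ := by
  classical
  refine Set.eq_empty_of_forall_notMem ?_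
  rintro W ⟨hL, -, hW⟩
  rw [orderLaurent, comap_maximalOrder] at hW
  rw [isLagrangian_iff] at hL
  set v := vertex b α k
  have hk0 : (0 : ℝ) < (k : ℝ)⁻¹ := by positivity
  have hk1 : (k : ℝ)⁻¹ < 1 := inv_lt_one_of_one_lt₀ (by exact_mod_cast hk)
  obtain ⟨γ, hγ⟩ := exists_neg_root (α : H.root)
  have hγv : (γ.1 v).re = -(k : ℝ)⁻¹ := by
    rw [← root_apply, hγ, LinearMap.neg_apply, root_vertex, if_pos rfl, Complex.neg_re,
      ← Complex.ofReal_natCast, ← Complex.ofReal_inv, Complex.ofReal_re]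
  obtain ⟨i, hi⟩ : ∃ i : RootBasisIndex H, i.1 = γ.1 := by
    have : Nontrivial (rootSpace H γ.1).toSubmodule :=
      (Submodule.nontrivial_iff_ne_bot).mpr fun h ↦
        γ.1.genWeightSpace_ne_bot' ((LieSubmodule.toSubmodule_eq_bot _).mp h)
    exact ⟨⟨γ.1, ⟨0, finrank_pos⟩⟩, rfl⟩
  rw [← hi] at hγv
  -- This is `u⁻¹ - 2 + u`: it vanishes at `u = 1 - ε`, and its term `u` has valuation `-1`, just
  -- outside the bound `-1/k` for the root `-α`.
  let p : ℂ[T;T⁻¹] := (.single (-1) 1 - 1) ^ 2 * .single 1 1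
  have hp : p ∈ valuationInftyGE (-1) := by
    have h1 : (.single (-1) 1 - 1 : ℂ[T;T⁻¹]) ∈ valuationInftyGE 0 :=
      sub_mem (single_mem_valuationInftyGE (by simp) _)
        (single_mem_valuationInftyGE (m := 0) (by simp) 1)
    have h2 : (.single 1 1 : ℂ[T;T⁻¹]) ∈ valuationInftyGE (-1) :=
      single_mem_valuationInftyGE (by simp) 1
    simpa [p, pow_two] using
      mul_mem_valuationInftyGE (mul_mem_valuationInftyGE h1 h1) h2
  have hpW : toLaurentAtZero 𝔤 (p ⊗ₜ rootBasis H i) ∈ W := by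
    refine (hL _).mp fun w hw ↦ ?_
    obtain ⟨g, hg, rfl⟩ := hW hw
    have hE : evalEps 𝔤 (p ⊗ₜ rootBasis H i) = 0 := by
      change substUnit onePlusEps⁻¹ p ⊗ₜ rootBasis H i = 0
      rw [substUnit_onePlusEps_inv_sq_mul, TensorProduct.zero_tmul]
    -- The element `p ⊗ e_i` is not in the order, so the valuation bound needed to compare the two
    -- forms has to be checked by hand.
    refine (residueForm_toLaurentAtZero ?_).trans (by rw [hE, map_zero])
    rw [baseChange_eq_sum (rootBasis H)]
    refine sum_mem fun j _ ↦ sum_mem fun l _ ↦ ?_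
    by_cases hK : killingForm ℂ 𝔤 (rootBasis H j) (rootBasis H l) = 0
    · simp [hK]
    refine Submodule.smul_mem _ _ ?_
    rcases eq_or_ne i l with rfl | hil
    · have h1 : (j.1 v).re = (k : ℝ)⁻¹ := by
        have := congr_arg Complex.re (rootBasis_add_eq_zero hK v)
        rw [Complex.add_re, hγv] at this
        simpa [add_neg_eq_zero] using this
      -- Valuations are integers, so the bound `1/k > 0` improves to `1`, which compensates for the
      -- valuation `-1` of `p`.
      have h2 : coords (rootBasis H) ℂ[T;T⁻¹] g j ∈ valuationInftyGE 1 := by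
        intro m hm
        refine hg j m ?_
        have hm : -m < 1 := by exact_mod_cast hm
        have : (0 : ℝ) ≤ m := by exact_mod_cast (by omega : 0 ≤ m)
        change -(m : ℝ) < (j.1 v).re
        rw [h1]
        linarith
      have h3 : coords (rootBasis H) ℂ[T;T⁻¹] (p ⊗ₜ[ℂ] rootBasis H i) i = p := by simp
      rw [h3, ← add_neg_cancel (1 : ℝ)]
      exact mul_mem_valuationInftyGE h2 hp
    · simp [hil]
  obtain ⟨g, hg, hgp⟩ := hW hpW
  have h1 : coords (rootBasis H) ℂ[T;T⁻¹] g i ∈ valuationInftyGE (i.1 v).re := hg i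
  rw [toLaurentAtZero_injective hgp, coords_tmul, Basis.repr_self, Finsupp.single_eq_same,
    one_smul, hγv] at h1
  -- Since `-1 < -1/k`, membership in the order would make the coefficient of `u` in `p` vanish, but
  -- it is `1`.
  have h2 := h1 1 (by push_cast; linarith)
  have h3 : (.single (-1) 1 * .single 1 1 : ℂ[T;T⁻¹]) = 1 := by
    rw [AddMonoidAlgebra.single_mul_single, neg_add_cancel, one_mul, AddMonoidAlgebra.one_def]
  have h4 : p = .single (-1) 1 - (1 + 1) + .single 1 1 := by
    linear_combination (.single (-1) 1 - 2) * h3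
  have h5 : (1 : ℂ[T;T⁻¹]).coeff 1 = 0 := by
    rw [AddMonoidAlgebra.one_def, AddMonoidAlgebra.coeff_single, Finsupp.single_apply,
      if_neg zero_ne_one]
  rw [h4] at h2
  simp [h5] at h2

end Roots

end LieBialg

end

theorem theorem2p4 {𝔤 : Type*} [LieRing 𝔤] [LieAlgebra ℂ 𝔤] [FiniteDimensional ℂ 𝔤]
    [LieAlgebra.IsSimple ℂ 𝔤] (H : LieSubalgebra ℂ 𝔤) [H.IsCartanSubalgebra]
    (b : (LieAlgebra.IsKilling.rootSystem H).Base)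
    (θ : H.root) (hθ : LieBialg.IsHighestRoot b θ)
    (k : b.support → ℕ)
    (hk : (LieAlgebra.IsKilling.rootSystem H).root θ =
      ∑ j : b.support, k j • (LieAlgebra.IsKilling.rootSystem H).root j)
    (α : b.support) :
    (k α = 1 →
      Set.BijOn LieBialg.evalSubalgebra
        (LieBialg.lagrangiansInOrder b α (k α)) (LieBialg.lagrangiansEps b α)) ∧
    (1 < k α → LieBialg.lagrangiansInOrder b α (k α) = ∅) := by
  refine ⟨fun h ↦ ?_, LieBialg.lagrangiansInOrder_eq_empty α⟩
  have := LieBialg.bijOn_lagrangiansInOrder hθ hk h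
  rwa [← h] at this
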